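/- Let $a_1,a_2,a_3$ be pairwise coprime positive integers, put $a=a_1a_2a_3$, and let $b,b_1,b_2,b_3$ be integers with $a\left(b+\frac{b_1}{a_1}+\frac{b_2}{a_2}+\frac{b_3}{a_3}\right)=1$, so that the Brieskorn homology sphere $\Sigma(a_1,a_2,a_3)$ is the Seifert fibered space $M(0;(1,b),(a_1,b_1),(a_2,b_2),(a_3,b_3))$. For integers $\beta,\beta_1,\beta_2,\beta_3$ let $$\pi(\beta;\beta_1,\beta_2,\beta_3)=\langle x,y,z,h\mid h\text{ central},\ x^{a_1}=h^{-\beta_1},\ y^{a_2}=h^{-\beta_2},\ z^{a_3}=h^{-\beta_3},\ xyz=h^{\beta}\rangle$$ be the fundamental group of $M(0;(1,\beta),(a_1,\beta_1),(a_2,\beta_2),(a_3,\beta_3))$; thus $\pi_1\Sigma(a_1,a_2,a_3)=\pi(b;b_1,b_2,b_3)$. Let $\Gamma=\langle x,y,z\mid x^{a_1}=y^{a_2}=z^{a_3}=xyz=1\rangle$ be the orbifold fundamental group of the base $S^2(a_1,a_2,a_3)$; each $\pi(\beta;\beta_1,\beta_2,\beta_3)$ projects onto $\Gamma$ by $x,y,z\mapsto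 x,y,z$ and $h\mapsto 1$. Let $\widetilde{PSL}(2;\mathbb R)$ be the universal cover of $PSL(2;\mathbb R)$, acting on $\mathbb R$ (the universal cover of $\mathbb RP^1\cong\mathbb R/\mathbb Z$), with center generated by $\mathrm{sh}(1):t\mapsto t+1$. A homomorphism $f:\Gamma\to PSL(2;\mathbb R)$ has Euler class $eu(f)=\beta x_0+\beta_1x_1+\beta_2x_2+\beta_3x_3$ in the abelian group $$H^2(\Gamma;\mathbb Z)=\langle x_0,x_1,x_2,x_3\mid a_1x_1=x_0,\ a_2x_2=x_0,\ a_3x_3=x_0\rangle$$ if the pull-back along $f$ of the central extension $0\to\mathbb Z\to\widetilde{PSL}(2;\mathbb R)\to PSL(2;\mathbb R)\to 1$ is equivalent, as a central extension of $\Gamma$ with $h\mapsto\mathrm{sh}(1)$, to $\pi(\beta;\beta_1,\beta_2,\beta_3)$. Composing $\pi(\beta;\beta_1,\beta_2,\beta_3)\to\widetilde{PSL}(2;\mathbb R)\to SL(2;\mathbb R)$ gives a representation $\overline\rho$. Let $p:\pi_1\Sigma(a_1,a_2,a_3)\to\pi(\beta;\beta_1,\beta_2,\beta_3)$ be induced by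 a fiber-preserving universal abelian covering, that is: $p$ is injective, its image is the commutator subgroup, and it covers an automorphism of $\Gamma$ that sends $x,y,z$ to conjugates of $x^{\varepsilon},y^{\varepsilon},z^{\varepsilon}$ for one sign $\varepsilon=\pm1$. Any representation $\rho_{eu}=\overline\rho\circ p$ of $\pi_1\Sigma(a_1,a_2,a_3)$ obtained in this way from some $f$ with $eu(f)=eu$ is said to be induced by $eu$. Let $E\subset H^2(\Gamma;\mathbb Z)$ be the set of classes $-x_0+\beta_1x_1+\beta_2x_2+\beta_3x_3$ with $0<\beta_i<a_i$ for $i=1,2,3$ and $\frac{\beta_1}{a_1}+\frac{\beta_2}{a_2}+\frac{\beta_3}{a_3}<1$, and let $\mathcal R_{SL(2;\mathbb R)}$ be the set of conjugacy classes, under conjugation by $SL(2;\mathbb C)$, of those representations $\pi_1\Sigma(a_1,a_2,a_3)\to SL(2;\mathbb R)$ that are irreducible as $SL(2;\mathbb C)$-representations. Then every $eu\in E$ induces a representation $\rho_{eu}$; every representation induced by $eu$ is irreducible as an $SL(2;\mathbb C)$-representation, and its class in $\mathcal R_{SL(2;\mathbb R)}$ depends only on $eu$; and the resulting map $\Phi:E\to\mathcal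 R_{SL(2;\mathbb R)}$, $\Phi(eu)=[\rho_{eu}]$, is injective. -/

import Mathlib

noncomputable section

namespace Brieskorn

open Matrix

open scoped commutatorElement

/-! ### Seifert fibered spaces over the sphere with three singular fibers: fundamental groups -/

/-- Generators of the Seifert presentation: `x 0, x 1, x 2` (usually called `x, y, z`) and the
regular fiber `h`. -/
inductive SeifertGen
  | x (i : Fin 3)
  | h

/-- The relators of `⟨x, y, z, h | h central, x ^ a₀ = h ^ (-b₀), y ^ a₁ = h ^ (-b₁),
z ^ a₂ = h ^ (-b₂), x y z = h ^ b⟩`. -/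
inductive IsSeifertRel (a : Fin 3 → ℕ) (b : ℤ) (bs : Fin 3 → ℤ) : FreeGroup SeifertGen → Prop
  | central (i : Fin 3) : IsSeifertRel a b bs
      ⁅FreeGroup.of SeifertGen.h, FreeGroup.of (SeifertGen.x i)⁆
  | cone (i : Fin 3) : IsSeifertRel a b bs
      (FreeGroup.of (SeifertGen.x i) ^ a i * FreeGroup.of SeifertGen.h ^ bs i)
  | prod : IsSeifertRel a b bs
      (FreeGroup.of (SeifertGen.x 0) * FreeGroup.of (SeifertGen.x 1) *
        FreeGroup.of (SeifertGen.x 2) * (FreeGroup.of SeifertGen.h ^ b)⁻¹)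

/-- The fundamental group of the Seifert fibered space
`M(0; (1, b), (a 0, bs 0), (a 1, bs 1), (a 2, bs 2))`, by its standard presentation. -/
abbrev SeifertGroup (a : Fin 3 → ℕ) (b : ℤ) (bs : Fin 3 → ℤ) : Type :=
  PresentedGroup {r | IsSeifertRel a b bs r}

/-- The generator `x i` of the Seifert group. -/
def SeifertGroup.x (a : Fin 3 → ℕ) (b : ℤ) (bs : Fin 3 → ℤ) (i : Fin 3) : SeifertGroup a b bs :=
  PresentedGroup.of (SeifertGen.x i)

/-- The regular fiber `h` in the Seifert group. -/
def SeifertGroup.h (a : Fin 3 → ℕ) (b : ℤ) (bs : Fin 3 → ℤ) : SeifertGroup a b bs :=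
  PresentedGroup.of SeifertGen.h

/-- The relators of `⟨x, y, z | x ^ a₀ = y ^ a₁ = z ^ a₂ = x y z = 1⟩`. -/
inductive IsOrbifoldRel (a : Fin 3 → ℕ) : FreeGroup (Fin 3) → Prop
  | cone (i : Fin 3) : IsOrbifoldRel a (FreeGroup.of i ^ a i)
  | prod : IsOrbifoldRel a (FreeGroup.of 0 * FreeGroup.of 1 * FreeGroup.of 2)

/-- The orbifold fundamental group `Γ(a 0, a 1, a 2)` of the sphere with three cone points. -/
abbrev OrbifoldGroup (a : Fin 3 → ℕ) : Type := PresentedGroup {r | IsOrbifoldRel a r}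

/-- The generator `x i` of the orbifold group. -/
def OrbifoldGroup.x (a : Fin 3 → ℕ) (i : Fin 3) : OrbifoldGroup a := PresentedGroup.of i

/-- Images of the Seifert generators in the orbifold group. -/
def toOrbifoldGen (a : Fin 3 → ℕ) : SeifertGen → OrbifoldGroup a
  | SeifertGen.x i => OrbifoldGroup.x a i
  | SeifertGen.h => 1

theorem toOrbifold_rel (a : Fin 3 → ℕ) (b : ℤ) (bs : Fin 3 → ℤ) :
    ∀ r ∈ {r | IsSeifertRel a b bs r}, FreeGroup.lift (toOrbifoldGen a) r = 1 := by
  intro r hr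
  cases hr with
  | central i => simp [toOrbifoldGen, commutatorElement_def]
  | cone i =>
    have := PresentedGroup.one_of_mem (rels := {r | IsOrbifoldRel a r}) (IsOrbifoldRel.cone i)
    simpa [toOrbifoldGen, OrbifoldGroup.x, PresentedGroup.of] using this
  | prod =>
    have := PresentedGroup.one_of_mem (rels := {r | IsOrbifoldRel a r}) IsOrbifoldRel.prod
    simpa [toOrbifoldGen, OrbifoldGroup.x, PresentedGroup.of] using this

/-- The projection from the Seifert group onto the orbifold group: `x i ↦ x i`, `h ↦ 1`. -/
def toOrbifold (a : Fin 3 → ℕ) (b : ℤ) (bs : Fin 3 → ℤ) :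
    SeifertGroup a b bs →* OrbifoldGroup a :=
  PresentedGroup.toGroup (toOrbifold_rel a b bs)

/-! ### The universal cover of `PSL(2, ℝ)` -/

/-- The universal cover of `PSL(2, ℝ)` (equivalently of `SL(2, ℝ)`), realized on the universal
cover `ℝ` of `ℝP¹`, where `t : ℝ` lies over the line spanned by `(cos π t, sin π t)`.
An element is a homeomorphism `F` of `ℝ` that lifts the projective action of some `A ∈ SL(2, ℝ)`.
Such an `F` determines `A` up to sign, and `A` is recorded with the sign for which `F` lifts the
action of `A` on rays, so `A` is determined by `F`. -/
def PSLtilde : Subgroup (SpecialLinearGroup (Fin 2) ℝ × (ℝ ≃ₜ ℝ)) where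
  carrier := {u | ∀ t : ℝ, ∃ c : ℝ, 0 < c ∧
    (u.1 : Matrix (Fin 2) (Fin 2) ℝ) *ᵥ ![Real.cos (Real.pi * t), Real.sin (Real.pi * t)] =
      c • ![Real.cos (Real.pi * u.2 t), Real.sin (Real.pi * u.2 t)]}
  one_mem' := fun t => ⟨1, one_pos, by simp⟩
  mul_mem' := by
    rintro ⟨A, F⟩ ⟨B, G⟩ hA hB t
    obtain ⟨c, hc, h⟩ := hB t
    obtain ⟨d, hd, k⟩ := hA (G t)
    refine ⟨c * d, mul_pos hc hd, ?_⟩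
    change ((A : Matrix (Fin 2) (Fin 2) ℝ) * (B : Matrix (Fin 2) (Fin 2) ℝ)) *ᵥ _ =
      (c * d) • ![Real.cos (Real.pi * F (G t)), Real.sin (Real.pi * F (G t))]
    rw [← mulVec_mulVec, h, mulVec_smul, k, smul_smul]
  inv_mem' := by
    rintro ⟨A, F⟩ hA t
    obtain ⟨c, hc, h⟩ := hA (F.symm t)
    refine ⟨c⁻¹, inv_pos.mpr hc, ?_⟩
    simp only [Homeomorph.apply_symm_apply] at h
    change ((A⁻¹ : SpecialLinearGroup (Fin 2) ℝ) : Matrix (Fin 2) (Fin 2) ℝ) *ᵥ _ =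
      c⁻¹ • ![Real.cos (Real.pi * F.symm t), Real.sin (Real.pi * F.symm t)]
    have h2 : ![Real.cos (Real.pi * t), Real.sin (Real.pi * t)] =
        c⁻¹ • ((A : Matrix (Fin 2) (Fin 2) ℝ) *ᵥ
          ![Real.cos (Real.pi * F.symm t), Real.sin (Real.pi * F.symm t)]) := by
      rw [h, smul_smul, inv_mul_cancel₀ hc.ne', one_smul]
    have h3 : ((A⁻¹ : SpecialLinearGroup (Fin 2) ℝ) : Matrix (Fin 2) (Fin 2) ℝ) *
        (A : Matrix (Fin 2) (Fin 2) ℝ) = 1 := congrArg Subtype.val (inv_mul_cancel A)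
    rw [h2, mulVec_smul, mulVec_mulVec, h3, one_mulVec]

/-- The projection of the universal cover onto `SL(2, ℝ)`. -/
def PSLtilde.toSL : PSLtilde →* SpecialLinearGroup (Fin 2) ℝ :=
  (MonoidHom.fst _ _).comp PSLtilde.subtype

/-- The projection of the universal cover onto `PSL(2, ℝ) = SL(2, ℝ) / {± I}`. -/
def PSLtilde.toPSL : PSLtilde →* ProjectiveSpecialLinearGroup (Fin 2) ℝ :=
  (QuotientGroup.mk' (Subgroup.center (SpecialLinearGroup (Fin 2) ℝ))).comp PSLtilde.toSL

/-- The translation `sh(1) : t ↦ t + 1`, a generator of the center of the universal cover;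
it lies over `- I ∈ SL(2, ℝ)`. -/
def PSLtilde.shOne : PSLtilde :=
  ⟨(-1, Homeomorph.addRight (1 : ℝ)), fun t => ⟨1, one_pos, by
    simp [mul_add, Real.cos_add_pi, Real.sin_add_pi, neg_mulVec]⟩⟩

/-! ### Euler classes -/

/-- The abelian group `⟨x₀, x₁, x₂, x₃ | a₁ x₁ = x₀, a₂ x₂ = x₀, a₃ x₃ = x₀⟩`, that is,
`H²(Γ(a₁, a₂, a₃); ℤ)`. The pair `(β, βs)` represents `β x₀ + ∑ i, βs i • x_{i + 1}`. -/
abbrev EulerGroup (a : Fin 3 → ℕ) : Type :=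
  (ℤ × (Fin 3 → ℤ)) ⧸ AddSubgroup.closure
    (Set.range fun i : Fin 3 => ((-1, Pi.single i (a i : ℤ)) : ℤ × (Fin 3 → ℤ)))

/-- The class `β x₀ + β₁ x₁ + β₂ x₂ + β₃ x₃`. -/
def eulerClass (a : Fin 3 → ℕ) (β : ℤ) (βs : Fin 3 → ℤ) : EulerGroup a :=
  QuotientAddGroup.mk (β, βs)

/-- The set `E` of Euler classes `- x₀ + β₁ x₁ + β₂ x₂ + β₃ x₃` with `0 < βᵢ < aᵢ` and
`β₁ / a₁ + β₂ / a₂ + β₃ / a₃ < 1`. -/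
def eulerSet (a : Fin 3 → ℕ) : Set (EulerGroup a) :=
  {γ | ∃ βs : Fin 3 → ℤ, (∀ i, 0 < βs i ∧ βs i < a i) ∧ ∑ i, (βs i : ℚ) / (a i : ℚ) < 1 ∧
    γ = eulerClass a (-1) βs}

/-- The pull-back along `f : Γ → PSL(2, ℝ)` of the central extension of `PSL(2, ℝ)` by `ℤ`
given by its universal cover: the pairs `(g, u)` with `f g` equal to the image of `u`. -/
def pullback {a : Fin 3 → ℕ} (f : OrbifoldGroup a →* ProjectiveSpecialLinearGroup (Fin 2) ℝ) :
    Subgroup (OrbifoldGroup a × PSLtilde) :=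
  (f.comp (MonoidHom.fst _ _)).eqLocus (PSLtilde.toPSL.comp (MonoidHom.snd _ _))

/-- `e` is an equivalence of central extensions of `Γ` by `ℤ` from the Seifert group with
invariants `β, βs` to the pull-back extension of `f`: it is the identity on `Γ` and sends `h` to
the generator `sh(1)`. Its existence says that the Euler class of `f` is
`β x₀ + β₁ x₁ + β₂ x₂ + β₃ x₃`. -/
def IsExtensionEquiv {a : Fin 3 → ℕ}
    (f : OrbifoldGroup a →* ProjectiveSpecialLinearGroup (Fin 2) ℝ) (β : ℤ) (βs : Fin 3 → ℤ)
    (e : SeifertGroup a β βs ≃* pullback f) : Prop :=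
  (∀ g, (e g : OrbifoldGroup a × PSLtilde).1 = toOrbifold a β βs g) ∧
    (e (SeifertGroup.h a β βs) : OrbifoldGroup a × PSLtilde) = (1, PSLtilde.shOne)

/-- The representation of the Seifert group into `SL(2, ℝ)` obtained from an equivalence `e`
with a pull-back extension, through the universal cover of `PSL(2, ℝ)`. -/
def baseRep {a : Fin 3 → ℕ} {f : OrbifoldGroup a →* ProjectiveSpecialLinearGroup (Fin 2) ℝ}
    {β : ℤ} {βs : Fin 3 → ℤ} (e : SeifertGroup a β βs ≃* pullback f) :
    SeifertGroup a β βs →* SpecialLinearGroup (Fin 2) ℝ :=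
  PSLtilde.toSL.comp ((MonoidHom.snd _ _).comp ((pullback f).subtype.comp e.toMonoidHom))

/-! ### The universal abelian covering and the induced representations -/

/-- `p` is induced by a fiber-preserving universal abelian covering between Seifert fibered
spaces over `S²(a 0, a 1, a 2)`: it is injective, its image is the commutator subgroup, and it
covers an automorphism `θ` of the orbifold group that comes from a homeomorphism of the base
orbifold, preserving (`ε = 1`) or reversing (`ε = -1`) the orientation. -/
def IsUniversalAbelianCover {a : Fin 3 → ℕ} {b β : ℤ} {bs βs : Fin 3 → ℤ}
    (p : SeifertGroup a b bs →* SeifertGroup a β βs) : Prop :=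
  Function.Injective p ∧ p.range = commutator (SeifertGroup a β βs) ∧
    ∃ (θ : OrbifoldGroup a ≃* OrbifoldGroup a) (ε : ℤˣ),
      (∀ i, IsConj (OrbifoldGroup.x a i ^ (ε : ℤ)) (θ (OrbifoldGroup.x a i))) ∧
      ∀ g, toOrbifold a β βs (p g) = θ (toOrbifold a b bs g)

/-- `ρ` is an `SL(2, ℝ)`-representation `ρ_eu` of the fundamental group of
`M(0; (1, b), (a 0, bs 0), (a 1, bs 1), (a 2, bs 2))` induced by the Euler class `eu`:
for some `f : Γ → PSL(2, ℝ)` with Euler class `eu = β x₀ + β₁ x₁ + β₂ x₂ + β₃ x₃`, it is the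
pull-back, along a universal abelian covering of the Seifert fibered space with invariants
`β, βs`, of the representation of the latter given by `f`. -/
def IsInduced {a : Fin 3 → ℕ} {b : ℤ} {bs : Fin 3 → ℤ} (eu : EulerGroup a)
    (ρ : SeifertGroup a b bs →* SpecialLinearGroup (Fin 2) ℝ) : Prop :=
  ∃ (β : ℤ) (βs : Fin 3 → ℤ) (f : OrbifoldGroup a →* ProjectiveSpecialLinearGroup (Fin 2) ℝ)
    (e : SeifertGroup a β βs ≃* pullback f) (p : SeifertGroup a b bs →* SeifertGroup a β βs),
    eu = eulerClass a β βs ∧ IsExtensionEquiv f β βs e ∧ IsUniversalAbelianCover p ∧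
      ρ = (baseRep e).comp p

/-! ### Conjugacy classes of irreducible representations -/

/-- The complexification of a representation into `SL(2, ℝ)`. -/
def complexify {G : Type*} [Group G] (ρ : G →* SpecialLinearGroup (Fin 2) ℝ) :
    G →* SpecialLinearGroup (Fin 2) ℂ :=
  (SpecialLinearGroup.map Complex.ofRealHom).comp ρ

/-- Irreducibility of a representation into `SL(2, ℂ)`: the only invariant subspaces of `ℂ²` are
the trivial ones. -/
def IsIrred {G : Type*} [Group G] (ρ : G →* SpecialLinearGroup (Fin 2) ℂ) : Prop :=
  ∀ W : Submodule ℂ (Fin 2 → ℂ),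
    (∀ g, ∀ v ∈ W, (ρ g : Matrix (Fin 2) (Fin 2) ℂ) *ᵥ v ∈ W) → W = ⊥ ∨ W = ⊤

/-- Representations into `SL(2, ℝ)` that are irreducible as `SL(2, ℂ)`-representations. -/
abbrev IrredRep (G : Type*) [Group G] : Type _ :=
  {ρ : G →* SpecialLinearGroup (Fin 2) ℝ // IsIrred (complexify ρ)}

/-- Conjugacy by a matrix in `SL(2, ℂ)`. -/
def conjSetoid (G : Type*) [Group G] : Setoid (IrredRep G) where
  r ρ σ := ∃ P : SpecialLinearGroup (Fin 2) ℂ,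
    ∀ g, P * complexify ρ.1 g * P⁻¹ = complexify σ.1 g
  iseqv :=
    { refl := fun _ => ⟨1, fun _ => by simp⟩
      symm := by
        rintro ρ σ ⟨P, h⟩
        exact ⟨P⁻¹, fun g => by rw [← h g]; group⟩
      trans := by
        rintro ρ σ τ ⟨P, h⟩ ⟨Q, k⟩
        exact ⟨Q * P, fun g => by rw [← k g, ← h g]; group⟩ }

/-- The set of conjugacy classes, under `SL(2, ℂ)`, of irreducible `SL(2, ℝ)`-representations. -/
abbrev RepClasses (G : Type*) [Group G] : Type _ := Quotient (conjSetoid G)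

/-- The conjugacy class of an irreducible representation. -/
def repClass {G : Type*} [Group G] (ρ : G →* SpecialLinearGroup (Fin 2) ℝ)
    (hρ : IsIrred (complexify ρ)) : RepClasses G :=
  Quotient.mk (conjSetoid G) ⟨ρ, hρ⟩

end Brieskorn

end

noncomputable section

namespace Brieskorn

open scoped commutatorElement

/-! ### Seifert groups -/

namespace SeifertGroup

variable {a : Fin 3 → ℕ} {b : ℤ} {bs : Fin 3 → ℤ}

/-! Everything is read off from one integer attached to the Euler class, the numerator `n = a₁a₂a₃(β
+ ∑ βᵢ/aᵢ)`. There are integers `cᵢ` with `aᵢcᵢ = βᵢ - n bᵢ` and `β + ∑ cᵢ = n b` (`exists_twist`),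
so `xᵢ ↦ xᵢ h^cᵢ`, `h ↦ h^n` is a homomorphism from the homology sphere group. Because that group is
perfect and `h` is central, its image is exactly the commutator subgroup. Comparing images shows
that every universal abelian covering sends `h` to `h^n` or `h^(-n)`.

Hence an induced `ρ` has `ρ(h) = (-1)^n`, and `ρ(xᵢ)` lifts to an element of the universal cover
whose `aᵢ`-th power is `sh(∓n bᵢ)`. Such an element has trace `2 cos(π n bᵢ/aᵢ)`
(`trace_of_pow_eq`), so the Euler class fixes these character values (`character_of_isInduced`). An
irreducible representation is determined up to conjugacy by them: `x₀`, `x₁` and `h` generate, and a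
pair in `SL(2, ℂ)` without common eigenvector is determined by the traces of its members and of
their product (`exists_conj_of_trace_eq`).

For a class in `E` put `rᵢ = βᵢ/aᵢ`, so that `n bᵢ/aᵢ = rᵢ - cᵢ` and `∑ cᵢ = n b + 1`. A common
eigenvector would make some `±r₀ ± r₁ ± r₂` an odd integer, which `rᵢ > 0` and `∑ rᵢ < 1` forbid;
this is irreducibility. If two classes give conjugate representations, each `rᵢ` equals `rᵢ'` or `1
- rᵢ'` according to the parity of `cᵢ - cᵢ'`. Parity of `∑ cᵢ` leaves zero or two exchanges, and two
would make the sums of the `rᵢ` and the `rᵢ'` add up to more than 2; this is injectivity.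

Existence is hyperbolic geometry: `∑ rᵢ < 1` is the condition for a triangle with angles `π rᵢ`, and
suitably lifted rotations about its vertices multiply to `sh(-1)` (`exists_triangle`). -/

theorem h_mul_x (i : Fin 3) : h a b bs * x a b bs i = x a b bs i * h a b bs := by
  have := PresentedGroup.one_of_mem (rels := {r | IsSeifertRel a b bs r}) (IsSeifertRel.central i)
  rw [map_commutatorElement, commutatorElement_eq_one_iff_mul_comm] at this
  exact this

theorem x_pow_mul (i : Fin 3) : x a b bs i ^ a i * h a b bs ^ bs i = 1 := by
  have := PresentedGroup.one_of_mem (rels := {r | IsSeifertRel a b bs r}) (IsSeifertRel.cone i)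
  simp only [map_mul, map_pow, map_zpow] at this
  exact this

theorem x_pow (i : Fin 3) : x a b bs i ^ a i = h a b bs ^ (-bs i) := by
  rw [zpow_neg]
  exact eq_inv_of_mul_eq_one_left (x_pow_mul i)

theorem x_mul_x_mul_x : x a b bs 0 * x a b bs 1 * x a b bs 2 = h a b bs ^ b := by
  have := PresentedGroup.one_of_mem (rels := {r | IsSeifertRel a b bs r}) IsSeifertRel.prod
  simp only [map_mul, map_zpow, map_inv] at this
  exact mul_inv_eq_one.mp this

theorem closure_eq_top : Subgroup.closure (Set.range (x a b bs) ∪ {h a b bs}) = ⊤ := by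
  rw [eq_top_iff, ← PresentedGroup.closure_range_of, Subgroup.closure_le]
  rintro _ ⟨g, rfl⟩
  cases g with
  | x i => exact Subgroup.subset_closure (Or.inl ⟨i, rfl⟩)
  | h => exact Subgroup.subset_closure (Or.inr rfl)

theorem mem_of_generators (K : Subgroup (SeifertGroup a b bs)) (hx : ∀ i, x a b bs i ∈ K)
    (hh : h a b bs ∈ K) (g : SeifertGroup a b bs) : g ∈ K := by
  have : Subgroup.closure (Set.range (x a b bs) ∪ {h a b bs}) ≤ K := by
    rw [Subgroup.closure_le]
    rintro _ (⟨i, rfl⟩ | rfl)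
    exacts [hx i, hh]
  rw [closure_eq_top] at this
  exact this (Subgroup.mem_top g)

theorem hom_ext {G : Type*} [Group G] {φ χ : SeifertGroup a b bs →* G}
    (hx : ∀ i, φ (x a b bs i) = χ (x a b bs i)) (hh : φ (h a b bs) = χ (h a b bs)) : φ = χ := by
  refine MonoidHom.ext fun g => ?_
  exact mem_of_generators (φ.eqLocus χ) hx hh g

theorem commute_h (g : SeifertGroup a b bs) : Commute (h a b bs) g := by
  have := mem_of_generators (Subgroup.centralizer {h a b bs})
    (fun i => by rw [Subgroup.mem_centralizer_singleton_iff]; exact (h_mul_x i).symm)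
    (by rw [Subgroup.mem_centralizer_singleton_iff]) g
  rw [Subgroup.mem_centralizer_singleton_iff] at this
  exact this.symm

/-- The images of the Seifert generators given by `X` and `H`. -/
def liftGen {G : Type*} (X : Fin 3 → G) (H : G) : SeifertGen → G
  | SeifertGen.x i => X i
  | SeifertGen.h => H

/-- The homomorphism out of the Seifert group given by elements that satisfy its relations. -/
def lift {G : Type*} [Group G] (X : Fin 3 → G) (H : G) (hc : ∀ i, Commute H (X i))
    (hp : ∀ i, X i ^ a i * H ^ bs i = 1) (hm : X 0 * X 1 * X 2 = H ^ b) :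
    SeifertGroup a b bs →* G :=
  PresentedGroup.toGroup (f := liftGen X H) (by
    intro r hr
    cases hr with
    | central i =>
      rw [map_commutatorElement, commutatorElement_eq_one_iff_mul_comm]
      simpa [liftGen] using (hc i).eq
    | cone i => simpa [liftGen] using hp i
    | prod => simpa [liftGen, mul_inv_eq_one] using hm)

section lift

variable {G : Type*} [Group G] (X : Fin 3 → G) (H : G) (hc : ∀ i, Commute H (X i))
    (hp : ∀ i, X i ^ a i * H ^ bs i = 1) (hm : X 0 * X 1 * X 2 = H ^ b)

@[simp] theorem lift_x (i : Fin 3) : lift X H hc hp hm (x a b bs i) = X i :=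
  PresentedGroup.toGroup.of _

@[simp] theorem lift_h : lift X H hc hp hm (h a b bs) = H :=
  PresentedGroup.toGroup.of _

end lift

@[simp] theorem toOrbifold_x (i : Fin 3) : toOrbifold a b bs (x a b bs i) = OrbifoldGroup.x a i :=
  PresentedGroup.toGroup.of _

@[simp] theorem toOrbifold_h : toOrbifold a b bs (h a b bs) = 1 :=
  PresentedGroup.toGroup.of _

theorem toOrbifold_surjective : Function.Surjective (toOrbifold a b bs) := by
  rw [← MonoidHom.range_eq_top, eq_top_iff, ← PresentedGroup.closure_range_of,
    Subgroup.closure_le]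
  rintro _ ⟨i, rfl⟩
  exact ⟨x a b bs i, toOrbifold_x i⟩

/-- Killing the central element `h` turns the Seifert relations into the orbifold relations. The
orbifold group therefore maps back to the quotient by `⟨h⟩`, and the kernel of the projection can be
no larger than `⟨h⟩`. -/
theorem exists_zpow_of_toOrbifold_eq_one {g : SeifertGroup a b bs}
    (hg : toOrbifold a b bs g = 1) : ∃ k : ℤ, g = h a b bs ^ k := by
  have hnorm : (Subgroup.zpowers (h a b bs)).Normal := by
    refine ⟨fun u hu v => ?_⟩
    obtain ⟨k, rfl⟩ := Subgroup.mem_zpowers_iff.mp hu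
    rw [← ((commute_h v).zpow_left k).eq, mul_inv_cancel_right]
    exact hu
  have hh : (QuotientGroup.mk' (Subgroup.zpowers (h a b bs))) (h a b bs) = 1 :=
    (QuotientGroup.eq_one_iff _).mpr (Subgroup.mem_zpowers _)
  let s : OrbifoldGroup a →* SeifertGroup a b bs ⧸ Subgroup.zpowers (h a b bs) :=
    PresentedGroup.toGroup (f := fun i => QuotientGroup.mk' _ (x a b bs i)) (by
      intro r hr
      cases hr with
      | cone i =>
        simp only [map_pow, FreeGroup.lift_apply_of]
        rw [← map_pow, x_pow, map_zpow, hh, one_zpow]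
      | prod =>
        simp only [map_mul, FreeGroup.lift_apply_of]
        rw [← map_mul, ← map_mul, x_mul_x_mul_x, map_zpow, hh, one_zpow])
  have hs : s.comp (toOrbifold a b bs) = QuotientGroup.mk' _ := by
    refine hom_ext (fun i => ?_) ?_
    · rw [MonoidHom.comp_apply, toOrbifold_x]
      exact PresentedGroup.toGroup.of _
    · rw [MonoidHom.comp_apply, toOrbifold_h, map_one, hh]
  have h1 : QuotientGroup.mk' (Subgroup.zpowers (h a b bs)) g = 1 := by
    rw [← hs, MonoidHom.comp_apply, hg, map_one]
  obtain ⟨k, hk⟩ := Subgroup.mem_zpowers_iff.mp ((QuotientGroup.eq_one_iff _).mp h1)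
  exact ⟨k, hk.symm⟩

/-- The Euler number condition of a homology sphere, with denominators cleared. -/
theorem cleared_of_euler (ha : ∀ i, 0 < a i)
    (hb : (∏ i, (a i : ℚ)) * ((b : ℚ) + ∑ i, (bs i : ℚ) / (a i : ℚ)) = 1) :
    (a 0 * a 1 * a 2 * b + a 1 * a 2 * bs 0 + a 0 * a 2 * bs 1 + a 0 * a 1 * bs 2 : ℤ) = 1 := by
  have h0 : (a 0 : ℚ) ≠ 0 := by exact_mod_cast (ha 0).ne'
  have h1 : (a 1 : ℚ) ≠ 0 := by exact_mod_cast (ha 1).ne'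
  have h2 : (a 2 : ℚ) ≠ 0 := by exact_mod_cast (ha 2).ne'
  rw [Fin.prod_univ_three, Fin.sum_univ_three] at hb
  have : (a 0 * a 1 * a 2 * b + a 1 * a 2 * bs 0 + a 0 * a 2 * bs 1 + a 0 * a 1 * bs 2 : ℚ) = 1 := by
    rw [← hb]
    field_simp
    ring
  exact_mod_cast this

/-- In an abelian group, the relations of a homology sphere force the generators to vanish. -/
theorem eq_one_of_comm {A : Type*} [CommGroup A] (φ : SeifertGroup a b bs →* A)
    (hb : (a 0 * a 1 * a 2 * b + a 1 * a 2 * bs 0 + a 0 * a 2 * bs 1 + a 0 * a 1 * bs 2 : ℤ) = 1) :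
    φ = 1 := by
  set X := fun i => Additive.ofMul (φ (x a b bs i)) with hX
  set H := Additive.ofMul (φ (h a b bs)) with hH
  have hp : ∀ i, (a i : ℤ) • X i + bs i • H = 0 := by
    intro i
    have := congrArg (fun g => Additive.ofMul (φ g)) (x_pow_mul (a := a) (b := b) (bs := bs) i)
    simpa [hX, hH] using this
  have hm : X 0 + X 1 + X 2 = b • H := by
    have := congrArg (fun g => Additive.ofMul (φ g)) (x_mul_x_mul_x (a := a) (b := b) (bs := bs))
    simpa [hX, hH] using this
  have hH0 : H = 0 := by
    -- Cramer's rule: the relation matrix has determinant `±1` by `hb`, and the coefficients are its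
    -- cofactors. The generators below are treated in the same way once `H = 0`.
    calc H = (1 : ℤ) • H := (one_smul _ _).symm
      _ = (a 0 * a 1 * a 2 : ℤ) • (b • H - (X 0 + X 1 + X 2)) +
          ((a 1 * a 2 : ℤ) • ((a 0 : ℤ) • X 0 + bs 0 • H) +
          (a 0 * a 2 : ℤ) • ((a 1 : ℤ) • X 1 + bs 1 • H) +
          (a 0 * a 1 : ℤ) • ((a 2 : ℤ) • X 2 + bs 2 • H)) := by rw [← hb]; module
      _ = 0 := by rw [hp, hp, hp, hm]; simp
  rw [hH0, smul_zero] at hm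
  have hp' : ∀ i, (a i : ℤ) • X i = 0 := fun i => by simpa [hH0] using hp i
  have e0 : X 0 = 0 := by
    calc X 0 = (1 : ℤ) • X 0 := (one_smul _ _).symm
      _ = (a 1 * a 2 * b + a 2 * bs 1 + a 1 * bs 2 : ℤ) • ((a 0 : ℤ) • X 0) +
          (a 1 * a 2 * bs 0 : ℤ) • (X 0 + X 1 + X 2) - (a 2 * bs 0 : ℤ) • ((a 1 : ℤ) • X 1)
          - (a 1 * bs 0 : ℤ) • ((a 2 : ℤ) • X 2) := by rw [← hb]; module
      _ = 0 := by rw [hp', hp', hp', hm]; simp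
  have e1 : X 1 = 0 := by
    calc X 1 = (1 : ℤ) • X 1 := (one_smul _ _).symm
      _ = (a 0 * a 2 * b + a 2 * bs 0 + a 0 * bs 2 : ℤ) • ((a 1 : ℤ) • X 1) +
          (a 0 * a 2 * bs 1 : ℤ) • (X 0 + X 1 + X 2) - (a 2 * bs 1 : ℤ) • ((a 0 : ℤ) • X 0)
          - (a 0 * bs 1 : ℤ) • ((a 2 : ℤ) • X 2) := by rw [← hb]; module
      _ = 0 := by rw [hp', hp', hp', hm]; simp
  have e2 : X 2 = 0 := by simpa [e0, e1] using hm
  refine hom_ext (fun i => ?_) hH0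
  fin_cases i
  exacts [e0, e1, e2]

theorem commutator_eq_top
    (hb : (a 0 * a 1 * a 2 * b + a 1 * a 2 * bs 0 + a 0 * a 2 * bs 1 + a 0 * a 1 * bs 2 : ℤ) = 1) :
    commutator (SeifertGroup a b bs) = ⊤ := by
  rw [← Abelianization.ker_of, eq_one_of_comm Abelianization.of hb, MonoidHom.ker_one]

end SeifertGroup

/-! ### The standard universal abelian covering -/

/-- The numerator `a₁ a₂ a₃ (β + ∑ βᵢ / aᵢ)` of the Euler number. -/
def eulerNum (a : Fin 3 → ℕ) (β : ℤ) (βs : Fin 3 → ℤ) : ℤ :=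
  a 0 * a 1 * a 2 * β + a 1 * a 2 * βs 0 + a 0 * a 2 * βs 1 + a 0 * a 1 * βs 2

/-- Modulo `aᵢ` the two Euler numerators reduce to `1 ≡ aⱼaₖbᵢ` and `n ≡ aⱼaₖβᵢ`, whence `n bᵢ ≡
βᵢ`. The second equation becomes an identity after multiplication by `a₀a₁a₂`. -/
theorem exists_twist {a : Fin 3 → ℕ} (ha : ∀ i, 0 < a i) {b : ℤ} {bs : Fin 3 → ℤ}
    (hb : eulerNum a b bs = 1) (β : ℤ) (βs : Fin 3 → ℤ) :
    ∃ c : Fin 3 → ℤ, (∀ i, a i * c i = βs i - eulerNum a β βs * bs i) ∧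
      β + c 0 + c 1 + c 2 = eulerNum a β βs * b := by
  set n := eulerNum a β βs with hn
  have h0 : ∀ i, ∃ c, a i * c = βs i - n * bs i := by
    simp only [eulerNum] at hn hb
    intro i
    fin_cases i
    -- Expand `βᵢ · 1 - n bᵢ` with `1` replaced by its expression in `hb`. The terms `aⱼaₖbᵢβᵢ`
    -- cancel and all others contain `aᵢ`.
    · refine ⟨βs 0 * (a 1 * a 2 * b + a 2 * bs 1 + a 1 * bs 2)
        - bs 0 * (a 1 * a 2 * β + a 2 * βs 1 + a 1 * βs 2), ?_⟩
      simp only [Fin.zero_eta, hn]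
      linear_combination βs 0 * hb
    · refine ⟨βs 1 * (a 0 * a 2 * b + a 2 * bs 0 + a 0 * bs 2)
        - bs 1 * (a 0 * a 2 * β + a 2 * βs 0 + a 0 * βs 2), ?_⟩
      simp only [Fin.mk_one, hn]
      linear_combination βs 1 * hb
    · refine ⟨βs 2 * (a 0 * a 1 * b + a 1 * bs 0 + a 0 * bs 1)
        - bs 2 * (a 0 * a 1 * β + a 1 * βs 0 + a 0 * βs 1), ?_⟩
      simp only [Fin.reduceFinMk, hn]
      linear_combination βs 2 * hb
  choose c hc using h0
  refine ⟨c, hc, ?_⟩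
  have hne : (a 0 * a 1 * a 2 : ℤ) ≠ 0 := by
    exact_mod_cast (Nat.mul_pos (Nat.mul_pos (ha 0) (ha 1)) (ha 2)).ne'
  refine mul_left_cancel₀ hne ?_
  simp only [eulerNum] at hn hb
  linear_combination (a 1 * a 2 : ℤ) * hc 0 + (a 0 * a 2 : ℤ) * hc 1 + (a 0 * a 1 : ℤ) * hc 2
    - hn - n * hb

namespace SeifertGroup

variable {a : Fin 3 → ℕ} {b β n : ℤ} {bs βs c : Fin 3 → ℤ}

/-- The homomorphism `xᵢ ↦ xᵢ h ^ cᵢ`, `h ↦ h ^ n` between Seifert groups. -/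
def cover (hc : ∀ i, a i * c i = βs i - n * bs i) (hs : β + c 0 + c 1 + c 2 = n * b) :
    SeifertGroup a b bs →* SeifertGroup a β βs :=
  lift (fun i => x a β βs i * h a β βs ^ c i) (h a β βs ^ n)
    (fun _ => (commute_h _).zpow_left n)
    (fun i => by
      rw [((commute_h (x a β βs i)).symm.zpow_right (c i)).mul_pow, x_pow, ← zpow_natCast,
        ← zpow_mul, ← zpow_mul, ← zpow_add, ← zpow_add]
      convert zpow_zero (h a β βs) using 2
      linear_combination hc i)
    (by
      have hz : ∀ (k : ℤ) g, g * h a β βs ^ k = h a β βs ^ k * g :=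
        fun k g => ((commute_h g).zpow_left k).eq.symm
      have : x a β βs 0 * h a β βs ^ c 0 * (x a β βs 1 * h a β βs ^ c 1) *
          (x a β βs 2 * h a β βs ^ c 2) = x a β βs 0 * x a β βs 1 * x a β βs 2 *
          (h a β βs ^ c 0 * h a β βs ^ c 1 * h a β βs ^ c 2) := by
        simp only [mul_assoc]
        congr 1
        rw [← mul_assoc (h a β βs ^ c 0), ← hz, mul_assoc]
        congr 1
        rw [← mul_assoc (h a β βs ^ c 1), ← hz, ← mul_assoc (h a β βs ^ c 0), ← hz]
        simp only [mul_assoc]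
        rw [← mul_assoc (h a β βs ^ c 1), ← hz]
        simp only [mul_assoc]
        congr 1
        rw [← zpow_add, ← zpow_add, ← zpow_add, ← zpow_add]
        ring_nf
      rw [this, x_mul_x_mul_x, ← zpow_add, ← zpow_add, ← zpow_add, ← zpow_mul]
      congr 1
      linear_combination hs)

variable (hc : ∀ i, a i * c i = βs i - n * bs i) (hs : β + c 0 + c 1 + c 2 = n * b)

@[simp] theorem cover_x (i : Fin 3) :
    cover hc hs (x a b bs i) = x a β βs i * h a β βs ^ c i := lift_x ..

@[simp] theorem cover_h : cover hc hs (h a b bs) = h a β βs ^ n := lift_h ..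

theorem toOrbifold_cover (g : SeifertGroup a b bs) :
    toOrbifold a β βs (cover hc hs g) = toOrbifold a b bs g := by
  have : (toOrbifold a β βs).comp (cover hc hs) = toOrbifold a b bs :=
    hom_ext (fun i => by simp) (by simp)
  exact DFunLike.congr_fun this g

theorem exists_cover_mul_zpow (g : SeifertGroup a β βs) :
    ∃ (u : SeifertGroup a b bs) (k : ℤ), g = cover hc hs u * h a β βs ^ k := by
  obtain ⟨u, hu⟩ := toOrbifold_surjective (a := a) (b := b) (bs := bs) (toOrbifold a β βs g)
  have : toOrbifold a β βs ((cover hc hs u)⁻¹ * g) = 1 := by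
    rw [map_mul, map_inv, toOrbifold_cover, hu, inv_mul_cancel]
  obtain ⟨k, hk⟩ := exists_zpow_of_toOrbifold_eq_one this
  exact ⟨u, k, by rw [← hk, mul_inv_cancel_left]⟩

/-- One inclusion holds because the source is perfect. For the other, every element of the target is
an image times a power of `h`, and commutators do not see central factors. -/
theorem range_cover (hb : eulerNum a b bs = 1) :
    (cover hc hs).range = commutator (SeifertGroup a β βs) := by
  apply le_antisymm
  · rw [MonoidHom.range_eq_map, ← commutator_eq_top hb, map_commutator_eq]
    exact Subgroup.commutator_mono le_top le_top
  · rw [commutator_def, Subgroup.commutator_le]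
    intro g _ g' _
    obtain ⟨u, k, rfl⟩ := exists_cover_mul_zpow hc hs g
    obtain ⟨v, l, rfl⟩ := exists_cover_mul_zpow hc hs g'
    refine ⟨⁅u, v⁆, ?_⟩
    have hz : ∀ (k : ℤ) (g : SeifertGroup a β βs), ⁅h a β βs ^ k, g⁆ = 1 := fun k g =>
      commutatorElement_eq_one_iff_commute.mpr ((commute_h g).zpow_left k)
    have hz' : ∀ (k : ℤ) (g : SeifertGroup a β βs), ⁅g, h a β βs ^ k⁆ = 1 := fun k g =>
      commutatorElement_eq_one_iff_commute.mpr ((commute_h g).symm.zpow_right k)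
    rw [map_commutatorElement, commutatorElement_mul_left_eq_conj_mul, hz, mul_one,
      mul_inv_cancel, one_mul, commutatorElement_mul_right_eq_mul_conj, hz']
    simp

/-- The map covers the identity of the orbifold group, so its kernel lies in `⟨h⟩`, where it
multiplies exponents by `n`. -/
theorem cover_injective (hn : n ≠ 0) (hh : ∀ k : ℤ, h a β βs ^ k = 1 → k = 0) :
    Function.Injective (cover hc hs) := by
  rw [injective_iff_map_eq_one]
  intro g hg
  obtain ⟨k, rfl⟩ := exists_zpow_of_toOrbifold_eq_one
    (show toOrbifold a b bs g = 1 by rw [← toOrbifold_cover hc hs, hg, map_one])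
  rw [map_zpow, cover_h, ← zpow_mul] at hg
  rcases mul_eq_zero.mp (hh _ hg) with h0 | h0
  · exact absurd h0 hn
  · rw [h0, zpow_zero]

theorem isUniversalAbelianCover_cover (hb : eulerNum a b bs = 1) (hn : n ≠ 0)
    (hh : ∀ k : ℤ, h a β βs ^ k = 1 → k = 0) : IsUniversalAbelianCover (cover hc hs) :=
  ⟨cover_injective hc hs hn hh, range_cover hc hs hb, MulEquiv.refl _, 1, fun i => by
    rw [Units.val_one, zpow_one]; exact IsConj.refl _,
    fun g => toOrbifold_cover hc hs g⟩

/-- A universal abelian covering has the degree of the standard one on the regular fiber, up to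
sign. -/
theorem map_h_of_isUniversalAbelianCover (hc : ∀ i, a i * c i = βs i - n * bs i)
    (hs : β + c 0 + c 1 + c 2 = n * b) (hb : eulerNum a b bs = 1)
    (hh : ∀ k : ℤ, h a β βs ^ k = 1 → k = 0) {p : SeifertGroup a b bs →* SeifertGroup a β βs}
    (hp : IsUniversalAbelianCover p) :
    p (h a b bs) = h a β βs ^ n ∨ p (h a b bs) = h a β βs ^ (-n) := by
  have hinj : ∀ k l : ℤ, h a β βs ^ k = h a β βs ^ l → k = l := fun k l hkl => by
    have := hh (k - l) (by rw [zpow_sub, hkl, mul_inv_cancel])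
    omega
  obtain ⟨-, hr, θ, -, -, hθ⟩ := hp
  obtain ⟨m, hm⟩ := exists_zpow_of_toOrbifold_eq_one (g := p (h a b bs)) (by simp [hθ])
  -- Both ranges equal the commutator subgroup, and an element mapped into `⟨h⟩` must itself be a
  -- power of `h`. So the powers of `h` in that subgroup are the multiples of `n` and equally the
  -- multiples of `m`.
  have h1 : n ∣ m := by
    have : h a β βs ^ m ∈ (cover hc hs).range := by
      rw [range_cover hc hs hb, ← hr, ← hm]
      exact ⟨_, rfl⟩
    obtain ⟨g, hg⟩ := this
    obtain ⟨k, rfl⟩ := exists_zpow_of_toOrbifold_eq_one (g := g)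
      (by rw [← toOrbifold_cover hc hs, hg]; simp)
    rw [map_zpow, cover_h, ← zpow_mul] at hg
    exact ⟨k, (hinj _ _ hg).symm⟩
  have h2 : m ∣ n := by
    have : h a β βs ^ n ∈ p.range := by
      rw [hr, ← range_cover hc hs hb]
      exact ⟨_, cover_h hc hs⟩
    obtain ⟨g, hg⟩ := this
    obtain ⟨k, rfl⟩ := exists_zpow_of_toOrbifold_eq_one (g := g)
      (θ.injective (by rw [← hθ, hg]; simp))
    rw [map_zpow, hm, ← zpow_mul] at hg
    exact ⟨k, (hinj _ _ hg).symm⟩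
  rcases Int.natAbs_eq_natAbs_iff.mp (Int.natAbs_eq_of_dvd_dvd h1 h2) with rfl | rfl
  · exact Or.inl hm
  · exact Or.inr (by rw [hm, neg_neg])

end SeifertGroup

open Matrix (SpecialLinearGroup trace)

open scoped Matrix

/-! ### The universal cover of `PSL(2, ℝ)` -/

/-- The unit vector `(cos π t, sin π t)`. -/
def dirVec (t : ℝ) : Fin 2 → ℝ := ![Real.cos (Real.pi * t), Real.sin (Real.pi * t)]

theorem dirVec_ne_zero (t : ℝ) : dirVec t ≠ 0 := by
  intro h
  have h0 : Real.cos (Real.pi * t) = 0 := congrFun h 0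
  have h1 : Real.sin (Real.pi * t) = 0 := congrFun h 1
  have := Real.sin_sq_add_cos_sq (Real.pi * t)
  simp [h0, h1] at this

theorem smul_dirVec_eq {c s t : ℝ} (hc : 0 < c) (h : dirVec s = c • dirVec t) :
    c = 1 ∧ ∃ k : ℤ, s = t + 2 * k := by
  have h0 : Real.cos (Real.pi * s) = c * Real.cos (Real.pi * t) := congrFun h 0
  have h1 : Real.sin (Real.pi * s) = c * Real.sin (Real.pi * t) := congrFun h 1
  have hs := Real.sin_sq_add_cos_sq (Real.pi * s)
  have ht := Real.sin_sq_add_cos_sq (Real.pi * t)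
  have hc1 : c = 1 := by
    rw [h0, h1] at hs
    have : c ^ 2 = 1 := by linear_combination hs - c ^ 2 * ht
    nlinarith
  subst hc1
  rw [one_mul] at h0 h1
  obtain ⟨k, hk⟩ := Real.Angle.angle_eq_iff_two_pi_dvd_sub.mp (Real.Angle.cos_sin_inj h0 h1)
  refine ⟨rfl, k, ?_⟩
  have : Real.pi * (s - t - 2 * k) = 0 := by linear_combination hk
  have := (mul_eq_zero.mp this).resolve_left Real.pi_ne_zero
  linarith

theorem dirVec_add_int (t : ℝ) (m : ℤ) : dirVec (t + m) = ((-1 : ℝ) ^ m) • dirVec t := by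
  ext i
  have : Real.pi * (t + m) = Real.pi * t + m * Real.pi := by ring
  fin_cases i
  · simp [dirVec, this, Real.cos_add_int_mul_pi]
  · simp [dirVec, this, Real.sin_add_int_mul_pi]

theorem exists_dirVec {v : Fin 2 → ℝ} (hv : v ≠ 0) : ∃ c t : ℝ, 0 < c ∧ v = c • dirVec t := by
  set z : ℂ := ⟨v 0, v 1⟩ with hz
  have hz0 : z ≠ 0 := by
    intro h
    apply hv
    ext i
    fin_cases i
    · exact congrArg Complex.re h
    · exact congrArg Complex.im h
  refine ⟨‖z‖, z.arg / Real.pi, norm_pos_iff.mpr hz0, ?_⟩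
  have hpi : Real.pi * (z.arg / Real.pi) = z.arg := by field_simp
  ext i
  fin_cases i
  · change z.re = ‖z‖ * Real.cos (Real.pi * (z.arg / Real.pi))
    rw [hpi, Complex.norm_mul_cos_arg]
  · change z.im = ‖z‖ * Real.sin (Real.pi * (z.arg / Real.pi))
    rw [hpi, Complex.norm_mul_sin_arg]

/-- A continuous function with values in a discrete lattice is constant. -/
theorem exists_const_of_continuous {g : ℝ → ℝ} (hg : Continuous g)
    (h : ∀ t, ∃ k : ℤ, g t = k) : ∃ k : ℤ, ∀ t, g t = k := by
  choose k hk using h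
  have hk' : Continuous k := by
    rw [Int.isClosedEmbedding_coe_real.continuous_iff]
    exact hg.congr hk
  exact ⟨k 0, fun t => by rw [hk, PreconnectedSpace.constant inferInstance hk' (y := 0)]⟩

theorem coe_neg_one_zpow {K : Type*} [Field K] (k : ℤ) :
    (((-1 : SpecialLinearGroup (Fin 2) K) ^ k : SpecialLinearGroup (Fin 2) K) :
      Matrix (Fin 2) (Fin 2) K) = ((-1 : K) ^ k) • 1 := by
  rcases Int.even_or_odd k with hk | hk
  · rw [hk.neg_one_zpow, hk.neg_one_zpow]; simp
  · rw [hk.neg_one_zpow, hk.neg_one_zpow]; simp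

namespace PSLtilde

/-- The action of an element of the universal cover on the line. -/
def act (X : PSLtilde) : ℝ ≃ₜ ℝ := X.1.2

theorem act_mul (X Y : PSLtilde) (t : ℝ) : act (X * Y) t = act X (act Y t) := rfl

theorem act_one (t : ℝ) : act 1 t = t := rfl

theorem act_shOne (t : ℝ) : act shOne t = t + 1 := rfl

theorem toSL_shOne : toSL shOne = -1 := rfl

theorem ext {X Y : PSLtilde} (h : toSL X = toSL Y) (h' : ∀ t, act X t = act Y t) : X = Y :=
  Subtype.ext (Prod.ext h (Homeomorph.ext h'))

theorem exists_pos_smul (X : PSLtilde) (t : ℝ) :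
    ∃ c : ℝ, 0 < c ∧ (toSL X : Matrix (Fin 2) (Fin 2) ℝ) *ᵥ dirVec t = c • dirVec (act X t) :=
  X.2 t

theorem act_inv_act (X : PSLtilde) (t : ℝ) : act X⁻¹ (act X t) = t := by
  rw [← act_mul, inv_mul_cancel, act_one]

theorem act_act_inv (X : PSLtilde) (t : ℝ) : act X (act X⁻¹ t) = t := by
  rw [← act_mul, mul_inv_cancel, act_one]

theorem act_shOne_zpow (k : ℤ) (t : ℝ) : act (shOne ^ k) t = t + k := by
  induction k using Int.induction_on generalizing t with
  | zero => simp [act_one]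
  | succ n ih => rw [zpow_add, zpow_one, act_mul, act_shOne, ih]; push_cast; ring
  | pred n ih =>
    rw [zpow_sub, zpow_one, act_mul]
    have : act shOne⁻¹ t = t - 1 := by
      have := act_inv_act shOne (t - 1)
      rwa [act_shOne, sub_add_cancel] at this
    rw [this, ih]; push_cast; ring

theorem shOne_zpow_injective {k l : ℤ} (h : shOne ^ k = shOne ^ l) : k = l := by
  have := congrArg (fun X => act X 0) h
  simpa [act_shOne_zpow] using this

theorem toSL_shOne_zpow (k : ℤ) :
    (toSL (shOne ^ k) : Matrix (Fin 2) (Fin 2) ℝ) = ((-1 : ℝ) ^ k) • 1 := by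
  rw [map_zpow, toSL_shOne, coe_neg_one_zpow]

/-- A lift of the identity on rays moves each point by an even integer, and continuity makes this
integer constant. -/
theorem eq_shOne_zpow_of_toSL_eq_one {X : PSLtilde} (h : toSL X = 1) :
    ∃ k : ℤ, X = shOne ^ (2 * k) := by
  have h1 : ∀ t, ∃ k : ℤ, (act X t - t) / 2 = k := by
    intro t
    obtain ⟨c, hc, hX⟩ := exists_pos_smul X t
    rw [h, Matrix.SpecialLinearGroup.coe_one, Matrix.one_mulVec] at hX
    obtain ⟨-, k, hk⟩ := smul_dirVec_eq hc hX
    refine ⟨-k, ?_⟩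
    push_cast
    linarith
  obtain ⟨k, hk⟩ := exists_const_of_continuous
    (((act X).continuous.sub continuous_id).div_const 2) h1
  refine ⟨k, ext ?_ fun t => ?_⟩
  · apply Subtype.ext
    rw [toSL_shOne_zpow, h]
    simp [zpow_mul]
  · rw [act_shOne_zpow]
    have : (act X t - t) / 2 = k := hk t
    push_cast
    linarith

theorem eq_shOne_zpow_of_toSL_eq_neg_one {X : PSLtilde} (h : toSL X = -1) :
    ∃ k : ℤ, X = shOne ^ (2 * k + 1) := by
  obtain ⟨k, hk⟩ := eq_shOne_zpow_of_toSL_eq_one (X := X * shOne⁻¹)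
    (by rw [map_mul, map_inv, h, toSL_shOne, mul_inv_cancel])
  exact ⟨k, by rw [zpow_add, ← hk, zpow_one, inv_mul_cancel_right]⟩

/-! #### Lifting matrices of nonnegative trace -/

/-- The complex number `A v / v`, where `v = e ^ (i π t)`. -/
def ratio (A : SpecialLinearGroup (Fin 2) ℝ) (t : ℝ) : ℂ :=
  ⟨((A : Matrix (Fin 2) (Fin 2) ℝ) *ᵥ dirVec t) ⬝ᵥ dirVec t,
    ((A : Matrix (Fin 2) (Fin 2) ℝ) *ᵥ dirVec t) ⬝ᵥ ![-dirVec t 1, dirVec t 0]⟩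

/-- The canonical lift of a matrix without negative eigenvalues. -/
def liftFun (A : SpecialLinearGroup (Fin 2) ℝ) (t : ℝ) : ℝ := t + (ratio A t).arg / Real.pi

theorem det_eq {K : Type*} [CommRing K] (A : SpecialLinearGroup (Fin 2) K) :
    A 0 0 * A 1 1 - A 0 1 * A 1 0 = 1 := by
  have := A.det_coe
  rwa [Matrix.det_fin_two] at this

/-- A value in `(-∞, 0]` would make `dirVec t` an eigenvector with eigenvalue `l ≤ 0`. But `l² - τ l
+ 1 ≥ 1` for such `l` when the trace `τ` is nonnegative. -/
theorem ratio_mem_slitPlane {A : SpecialLinearGroup (Fin 2) ℝ} (hA : 0 ≤ A 0 0 + A 1 1) (t : ℝ) :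
    ratio A t ∈ Complex.slitPlane := by
  rw [Complex.mem_slitPlane_iff]
  by_contra! h
  obtain ⟨h1, h2⟩ := h
  simp only [ratio, dirVec, Matrix.mulVec, dotProduct, Fin.sum_univ_two, Matrix.cons_val_zero,
    Matrix.cons_val_one] at h1 h2
  have h3 := Real.sin_sq_add_cos_sq (Real.pi * t)
  have h4 := det_eq A
  set C := Real.cos (Real.pi * t)
  set S := Real.sin (Real.pi * t)
  set p := A 0 0
  set q := A 0 1
  set r := A 1 0
  set s := A 1 1
  set l := (p * C + q * S) * C + (r * C + s * S) * S with hl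
  have e1 : p * C + q * S = l * C := by linear_combination -(p * C + q * S) * h3 - S * h2
  have e2 : r * C + s * S = l * S := by linear_combination -(r * C + s * S) * h3 + C * h2
  -- The characteristic polynomial at `l` kills both coordinates of the unit vector, hence vanishes.
  have e3 : ((p - l) * (s - l) - q * r) * C = 0 := by linear_combination (s - l) * e1 - q * e2
  have e4 : ((p - l) * (s - l) - q * r) * S = 0 := by linear_combination (p - l) * e2 - r * e1
  have e5 : (p - l) * (s - l) - q * r = 0 := by linear_combination C * e3 + S * e4 -
    ((p - l) * (s - l) - q * r) * h3
  nlinarith [mul_nonneg hA (neg_nonneg.mpr h1)]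

theorem continuous_liftFun {A : SpecialLinearGroup (Fin 2) ℝ} (hA : 0 ≤ A 0 0 + A 1 1) :
    Continuous (liftFun A) := by
  have hr : Continuous (ratio A) := by
    have : ratio A = fun t => (((A : Matrix (Fin 2) (Fin 2) ℝ) *ᵥ dirVec t) ⬝ᵥ dirVec t : ℝ) +
        (((A : Matrix (Fin 2) (Fin 2) ℝ) *ᵥ dirVec t) ⬝ᵥ ![-dirVec t 1, dirVec t 0] : ℝ) *
          Complex.I := by
      ext t
      rw [← Complex.mk_eq_add_mul_I]
      rfl
    rw [this]
    simp only [dirVec, Matrix.mulVec, dotProduct, Fin.sum_univ_two, Matrix.cons_val_zero,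
      Matrix.cons_val_one]
    fun_prop
  refine continuous_id.add (Continuous.div_const ?_ _)
  rw [continuous_iff_continuousAt]
  exact fun t => (Complex.continuousAt_arg (ratio_mem_slitPlane hA t)).comp hr.continuousAt

theorem mulVec_dirVec_liftFun {A : SpecialLinearGroup (Fin 2) ℝ} (hA : 0 ≤ A 0 0 + A 1 1)
    (t : ℝ) : ∃ c : ℝ, 0 < c ∧
      (A : Matrix (Fin 2) (Fin 2) ℝ) *ᵥ dirVec t = c • dirVec (liftFun A t) := by
  refine ⟨‖ratio A t‖, norm_pos_iff.mpr (Complex.slitPlane_ne_zero (ratio_mem_slitPlane hA t)), ?_⟩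
  have hpi : Real.pi * liftFun A t = Real.pi * t + (ratio A t).arg := by
    rw [liftFun]; field_simp
  have hc := Complex.norm_mul_cos_arg (ratio A t)
  have hs := Complex.norm_mul_sin_arg (ratio A t)
  have h3 := Real.sin_sq_add_cos_sq (Real.pi * t)
  have e0 : dirVec (liftFun A t) =
      ![Real.cos (Real.pi * t + (ratio A t).arg), Real.sin (Real.pi * t + (ratio A t).arg)] := by
    rw [dirVec, hpi]
  simp only [ratio, dotProduct, Fin.sum_univ_two, dirVec, Matrix.cons_val_zero,
    Matrix.cons_val_one] at hc hs
  rw [e0]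
  ext i
  fin_cases i
  · simp only [Fin.zero_eta, Pi.smul_apply, smul_eq_mul, Matrix.cons_val_zero, Real.cos_add]
    simp only [ratio, dotProduct, Fin.sum_univ_two, dirVec, Matrix.cons_val_zero,
      Matrix.cons_val_one]
    linear_combination -Real.cos (Real.pi * t) * hc + Real.sin (Real.pi * t) * hs -
      ((A : Matrix (Fin 2) (Fin 2) ℝ) *ᵥ
        ![Real.cos (Real.pi * t), Real.sin (Real.pi * t)]) 0 * h3
  · simp only [Fin.mk_one, Pi.smul_apply, smul_eq_mul, Matrix.cons_val_one, Real.sin_add]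
    simp only [ratio, dotProduct, Fin.sum_univ_two, dirVec, Matrix.cons_val_zero,
      Matrix.cons_val_one]
    linear_combination -Real.sin (Real.pi * t) * hc - Real.cos (Real.pi * t) * hs -
      ((A : Matrix (Fin 2) (Fin 2) ℝ) *ᵥ
        ![Real.cos (Real.pi * t), Real.sin (Real.pi * t)]) 1 * h3

theorem abs_liftFun_sub_lt {A : SpecialLinearGroup (Fin 2) ℝ} (hA : 0 ≤ A 0 0 + A 1 1) (t : ℝ) :
    |liftFun A t - t| < 1 := by
  have h1 : |(ratio A t).arg| < Real.pi := by
    have := Complex.mem_slitPlane_iff_arg.mp (ratio_mem_slitPlane hA t)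
    exact lt_of_le_of_ne (Complex.abs_arg_le_pi _) fun h => by
      rcases abs_eq Real.pi_pos.le |>.mp h with h | h
      · exact this.1 h
      · exact (Complex.neg_pi_lt_arg _).ne' h
  rw [liftFun, add_sub_cancel_left, abs_div, abs_of_pos Real.pi_pos]
  rwa [div_lt_one Real.pi_pos]

theorem liftFun_add_one (A : SpecialLinearGroup (Fin 2) ℝ) (t : ℝ) :
    liftFun A (t + 1) = liftFun A t + 1 := by
  have : ratio A (t + 1) = ratio A t := by
    have h := dirVec_add_int t 1
    rw [Int.cast_one, zpow_one] at h
    rw [ratio, ratio, h]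
    apply Complex.ext
    · simp [Matrix.mulVec_neg, dotProduct]
    · simp [Matrix.mulVec_neg, dotProduct]; ring
  rw [liftFun, liftFun, this]
  ring

/-- The composite lifts the identity, so it is translation by an even integer at `t`. Each factor
moves points by less than 1, which leaves only 0. -/
theorem liftFun_liftFun {A B : SpecialLinearGroup (Fin 2) ℝ} (hA : 0 ≤ A 0 0 + A 1 1)
    (hB : 0 ≤ B 0 0 + B 1 1) (h : B * A = 1) (t : ℝ) : liftFun B (liftFun A t) = t := by
  obtain ⟨c, hc, h1⟩ := mulVec_dirVec_liftFun hA t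
  obtain ⟨d, hd, h2⟩ := mulVec_dirVec_liftFun hB (liftFun A t)
  have h3 : dirVec t = (c * d) • dirVec (liftFun B (liftFun A t)) := by
    rw [mul_smul, ← h2, ← Matrix.mulVec_smul, ← h1, Matrix.mulVec_mulVec]
    have : (B : Matrix (Fin 2) (Fin 2) ℝ) * A = 1 := congrArg Subtype.val h
    rw [this, Matrix.one_mulVec]
  obtain ⟨-, k, hk⟩ := smul_dirVec_eq (mul_pos hc hd) h3
  have b1 := abs_lt.mp (abs_liftFun_sub_lt hA t)
  have b2 := abs_lt.mp (abs_liftFun_sub_lt hB (liftFun A t))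
  have k1 : (k : ℝ) < 1 := by linarith
  have k2 : (-1 : ℝ) < k := by linarith
  have k0 : k = 0 := by
    have : k < 1 := by exact_mod_cast k1
    have : -1 < k := by exact_mod_cast k2
    omega
  rw [k0] at hk
  simpa using hk.symm

theorem exists_lift_of_trace_nonneg {A : SpecialLinearGroup (Fin 2) ℝ}
    (hA : 0 ≤ A 0 0 + A 1 1) :
    ∃ X : PSLtilde, toSL X = A ∧ (∀ t, act X (t + 1) = act X t + 1) ∧ ∀ t, |act X t - t| < 1 := by
  have hA' : 0 ≤ A⁻¹ 0 0 + A⁻¹ 1 1 := by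
    rw [Matrix.SpecialLinearGroup.SL2_inv_expl]
    simpa [add_comm] using hA
  exact ⟨⟨(A, ⟨⟨liftFun A, liftFun A⁻¹, liftFun_liftFun hA hA' (inv_mul_cancel A),
    liftFun_liftFun hA' hA (mul_inv_cancel A)⟩, continuous_liftFun hA, continuous_liftFun hA'⟩),
    mulVec_dirVec_liftFun hA⟩, rfl, liftFun_add_one A, abs_liftFun_sub_lt hA⟩

theorem exists_toSL_eq_or_neg (A : SpecialLinearGroup (Fin 2) ℝ) :
    ∃ X : PSLtilde, (toSL X = A ∨ toSL X = -A) ∧ ∀ t, act X (t + 1) = act X t + 1 := by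
  rcases le_total 0 (A 0 0 + A 1 1) with h | h
  · obtain ⟨X, h1, h2, -⟩ := exists_lift_of_trace_nonneg h
    exact ⟨X, Or.inl h1, h2⟩
  · obtain ⟨X, h1, h2, -⟩ := exists_lift_of_trace_nonneg (A := -A) (by simp; linarith)
    exact ⟨X, Or.inr h1, h2⟩

theorem toSL_surjective : Function.Surjective toSL := by
  intro A
  obtain ⟨X, h | h, -⟩ := exists_toSL_eq_or_neg A
  · exact ⟨X, h⟩
  · exact ⟨X * shOne, by rw [map_mul, h, toSL_shOne]; simp⟩

/-- The canonical lift of `± toSL X` commutes with the unit translation, because `ratio` has period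
1, and `X` differs from that lift by an integer translation. -/
theorem act_add_one (X : PSLtilde) (t : ℝ) : act X (t + 1) = act X t + 1 := by
  obtain ⟨Y, h, hY⟩ := exists_toSL_eq_or_neg (toSL X)
  have : ∃ k : ℤ, X * Y⁻¹ = shOne ^ k := by
    rcases h with h | h
    · obtain ⟨k, hk⟩ := eq_shOne_zpow_of_toSL_eq_one (X := X * Y⁻¹)
        (by rw [map_mul, map_inv, h, mul_inv_cancel])
      exact ⟨_, hk⟩
    · obtain ⟨k, hk⟩ := eq_shOne_zpow_of_toSL_eq_neg_one (X := X * Y⁻¹)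
        (by rw [map_mul, map_inv, h]; exact mul_inv_eq_of_eq_mul (by simp))
      exact ⟨_, hk⟩
  obtain ⟨k, hk⟩ := this
  rw [mul_inv_eq_iff_eq_mul.mp hk, act_mul, act_mul, hY, act_shOne_zpow, act_shOne_zpow]
  ring

theorem commute_shOne (X : PSLtilde) : Commute X shOne := by
  refine ext ?_ fun t => ?_
  · rw [map_mul, map_mul, toSL_shOne]; simp
  · rw [act_mul, act_mul, act_shOne, act_shOne, act_add_one]

theorem commute_shOne_zpow (X : PSLtilde) (k : ℤ) : Commute X (shOne ^ k) :=
  (commute_shOne X).zpow_right k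

theorem act_add_int (X : PSLtilde) (t : ℝ) (k : ℤ) : act X (t + k) = act X t + k := by
  rw [← act_shOne_zpow, ← act_shOne_zpow, ← act_mul, ← act_mul, (commute_shOne_zpow X k).eq]

theorem eq_mul_shOne_zpow_of_toSL_eq {X Y : PSLtilde} (h : toSL X = toSL Y) :
    ∃ k : ℤ, X = Y * shOne ^ (2 * k) := by
  obtain ⟨k, hk⟩ := eq_shOne_zpow_of_toSL_eq_one (X := Y⁻¹ * X)
    (by rw [map_mul, map_inv, h, inv_mul_cancel])
  exact ⟨k, by rw [← hk, mul_inv_cancel_left]⟩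

theorem eq_mul_shOne_zpow_of_toPSL_eq {X Y : PSLtilde} (h : toPSL X = toPSL Y) :
    ∃ k : ℤ, X = Y * shOne ^ k := by
  have h1 : (toSL Y)⁻¹ * toSL X ∈ Subgroup.center (SpecialLinearGroup (Fin 2) ℝ) :=
    QuotientGroup.eq.mp h.symm
  obtain ⟨r, hr, hs⟩ := Matrix.SpecialLinearGroup.mem_center_iff.mp h1
  rw [Fintype.card_fin, sq_eq_one_iff] at hr
  rw [← map_inv, ← map_mul] at hs
  rcases hr with rfl | rfl
  · obtain ⟨k, hk⟩ := eq_shOne_zpow_of_toSL_eq_one (X := Y⁻¹ * X)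
      (Subtype.ext (by rw [← hs]; simp))
    exact ⟨_, by rw [← hk, mul_inv_cancel_left]⟩
  · obtain ⟨k, hk⟩ := eq_shOne_zpow_of_toSL_eq_neg_one (X := Y⁻¹ * X)
      (Subtype.ext (by rw [← hs, map_neg, map_one]; rfl))
    exact ⟨_, by rw [← hk, mul_inv_cancel_left]⟩

theorem toPSL_shOne : toPSL shOne = 1 := by
  refine (QuotientGroup.eq_one_iff _).mpr (Matrix.SpecialLinearGroup.mem_center_iff.mpr
    ⟨-1, by simp, ?_⟩)
  rw [toSL_shOne, map_neg, map_one]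
  rfl

/-! #### Rotations -/

/-- The rotation of the plane by the angle `θ`. -/
def rotMat (θ : ℝ) : SpecialLinearGroup (Fin 2) ℝ :=
  ⟨!![Real.cos θ, -Real.sin θ; Real.sin θ, Real.cos θ], by
    rw [Matrix.det_fin_two_of]
    linear_combination Real.sin_sq_add_cos_sq θ⟩

theorem rotMat_add (θ φ : ℝ) : rotMat (θ + φ) = rotMat θ * rotMat φ := by
  apply Subtype.ext
  rw [Matrix.SpecialLinearGroup.coe_mul]
  ext i j
  rw [Matrix.mul_apply, Fin.sum_univ_two]
  fin_cases i <;> fin_cases j <;> simp [rotMat, Real.cos_add, Real.sin_add] <;> ring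

/-- The translation `sh(s) : t ↦ t + s`, which lies over the rotation by `π s`. -/
def sh (s : ℝ) : PSLtilde :=
  ⟨(rotMat (Real.pi * s), Homeomorph.addRight s), fun t => ⟨1, one_pos, by
    ext i
    fin_cases i
    · simp [rotMat, Matrix.mulVec, dotProduct, mul_add, Real.cos_add]; ring
    · simp [rotMat, Matrix.mulVec, dotProduct, mul_add, Real.sin_add]; ring⟩⟩

theorem toSL_sh (s : ℝ) : toSL (sh s) = rotMat (Real.pi * s) := rfl

theorem act_sh (s t : ℝ) : act (sh s) t = t + s := rfl

theorem sh_add (s t : ℝ) : sh (s + t) = sh s * sh t := by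
  refine ext ?_ fun u => ?_
  · rw [map_mul, toSL_sh, toSL_sh, toSL_sh, mul_add, rotMat_add]
  · rw [act_mul, act_sh, act_sh, act_sh]; ring

theorem sh_pow (s : ℝ) (n : ℕ) : sh s ^ n = sh (n * s) := by
  induction n with
  | zero =>
    refine ext ?_ fun u => ?_
    · rw [pow_zero, map_one, toSL_sh]
      apply Subtype.ext
      ext i j
      fin_cases i <;> fin_cases j <;> simp [rotMat]
    · rw [pow_zero, act_one, act_sh]; simp
  | succ n ih =>
    rw [pow_succ, ih, ← sh_add]
    push_cast
    congr 1
    ring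

theorem sh_intCast (k : ℤ) : sh k = shOne ^ k := by
  refine ext (Subtype.ext ?_) fun t => ?_
  · rw [toSL_shOne_zpow, toSL_sh, mul_comm]
    ext i j
    fin_cases i <;> fin_cases j <;> simp [rotMat, Real.cos_int_mul_pi, Real.sin_int_mul_pi]
  · rw [act_sh, act_shOne_zpow]

end PSLtilde

namespace PSLtilde

/-! #### Elliptic elements and elements of finite order modulo the center -/

/-- An elliptic matrix is conjugate to a rotation. -/
theorem exists_eq_conj_rotMat {A : SpecialLinearGroup (Fin 2) ℝ} {θ : ℝ}
    (htr : A 0 0 + A 1 1 = 2 * Real.cos θ) (hs : 0 < A 1 0 * Real.sin θ) :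
    ∃ P : SpecialLinearGroup (Fin 2) ℝ, A = P * rotMat θ * P⁻¹ := by
  have hdet := det_eq A
  have h1 := Real.sin_sq_add_cos_sq θ
  have hs0 : Real.sin θ ≠ 0 := right_ne_zero_of_mul hs.ne'
  have hr0 : A 1 0 ≠ 0 := left_ne_zero_of_mul hs.ne'
  have hpos : 0 < Real.sin θ / A 1 0 := by
    rcases mul_pos_iff.mp hs with ⟨h, h'⟩ | ⟨h, h'⟩
    exacts [div_pos h' h, div_pos_of_neg_of_neg h' h]
  set k := Real.sqrt (Real.sin θ / A 1 0) with hk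
  have hk2 : k ^ 2 = Real.sin θ / A 1 0 := Real.sq_sqrt hpos.le
  -- The first column is `k e₁`; the equation `A P = P R` then forces the second to be `k (A e₁ -
  -- cos θ e₁) / sin θ`. Determinant 1 requires `k² = sin θ / A₁₀`, which is where the sign
  -- condition `hs` enters: it selects the sense of rotation.
  obtain ⟨P, hP⟩ : ∃ P : SpecialLinearGroup (Fin 2) ℝ, (P : Matrix (Fin 2) (Fin 2) ℝ) =
      !![k, k * (A 0 0 - Real.cos θ) / Real.sin θ; 0, k * A 1 0 / Real.sin θ] := by
    refine ⟨⟨_, ?_⟩, rfl⟩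
    rw [Matrix.det_fin_two_of]
    have : k * (k * A 1 0 / Real.sin θ) = k ^ 2 * (A 1 0 / Real.sin θ) := by ring
    rw [this, hk2]
    field_simp
    ring
  refine ⟨P, ?_⟩
  · rw [eq_mul_inv_iff_mul_eq]
    apply Subtype.ext
    rw [Matrix.SpecialLinearGroup.coe_mul, Matrix.SpecialLinearGroup.coe_mul, hP]
    ext i j
    rw [Matrix.mul_apply, Fin.sum_univ_two, Matrix.mul_apply, Fin.sum_univ_two]
    fin_cases i <;> fin_cases j <;> simp [rotMat] <;> field_simp
    · ring
    · linear_combination k * A 0 0 * htr - k * hdet + k * h1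
    · linear_combination k * htr

theorem conj_sh_mul_pow (Y : PSLtilde) (s : ℝ) (j : ℤ) (n : ℕ) :
    (Y * sh s * Y⁻¹ * shOne ^ j) ^ n = Y * sh (n * s) * Y⁻¹ * shOne ^ (j * n) := by
  rw [(commute_shOne_zpow _ j).mul_pow, conj_pow, sh_pow, zpow_mul, zpow_natCast]

theorem exists_eq_conj_sh {X : PSLtilde} {s : ℝ}
    (htr : toSL X 0 0 + toSL X 1 1 = 2 * Real.cos (Real.pi * s))
    (hs : 0 < toSL X 1 0 * Real.sin (Real.pi * s)) :
    ∃ (Y : PSLtilde) (j : ℤ), X = Y * sh s * Y⁻¹ * shOne ^ (2 * j) := by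
  obtain ⟨P, hP⟩ := exists_eq_conj_rotMat htr hs
  obtain ⟨Y, rfl⟩ := toSL_surjective P
  obtain ⟨j, hj⟩ := eq_mul_shOne_zpow_of_toSL_eq (X := X) (Y := Y * sh s * Y⁻¹)
    (by rw [hP, map_mul, map_mul, map_inv, toSL_sh])
  exact ⟨Y, j, hj⟩

theorem inv_apply (A : SpecialLinearGroup (Fin 2) ℝ) :
    A⁻¹ 0 0 = A 1 1 ∧ A⁻¹ 1 0 = -A 1 0 ∧ A⁻¹ 1 1 = A 0 0 := by
  rw [Matrix.SpecialLinearGroup.SL2_inv_expl]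
  exact ⟨rfl, rfl, rfl⟩

theorem exists_eigenvector {K : Type*} [Field K] {A : SpecialLinearGroup (Fin 2) K} {l : K}
    (hl : l ^ 2 - (A 0 0 + A 1 1) * l + 1 = 0) :
    ∃ v : Fin 2 → K, v ≠ 0 ∧ (A : Matrix (Fin 2) (Fin 2) K) *ᵥ v = l • v := by
  have hdet : ((A : Matrix (Fin 2) (Fin 2) K) - l • 1).det = 0 := by
    have h := A.det_coe
    rw [Matrix.det_fin_two] at h ⊢
    simp only [Matrix.sub_apply, Matrix.smul_apply, Matrix.one_apply_eq, smul_eq_mul, mul_one,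
      ne_eq, zero_ne_one, one_ne_zero, not_false_eq_true, Matrix.one_apply_ne, mul_zero, sub_zero]
    linear_combination h + hl
  obtain ⟨v, hv, h⟩ := Matrix.exists_mulVec_eq_zero_iff.mpr hdet
  refine ⟨v, hv, ?_⟩
  rwa [Matrix.sub_mulVec, Matrix.smul_mulVec, Matrix.one_mulVec, sub_eq_zero] at h

theorem act_of_eigenvector {X : PSLtilde} {l t : ℝ}
    (h : (toSL X : Matrix (Fin 2) (Fin 2) ℝ) *ᵥ dirVec t = l • dirVec t) :
    ∃ m : ℤ, act X t = t + m ∧ l = (-1) ^ m * |l| := by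
  obtain ⟨d, hd, hX⟩ := exists_pos_smul X t
  rw [h] at hX
  have hl : l ≠ 0 := by
    rintro rfl
    rw [zero_smul] at hX
    exact (smul_ne_zero hd.ne' (dirVec_ne_zero _)) hX.symm
  rcases lt_or_gt_of_ne hl with hl | hl
  · have h1 : dirVec (t + (1 : ℤ)) = (-l⁻¹ * d) • dirVec (act X t) := by
      rw [mul_smul, ← hX, smul_smul, dirVec_add_int, zpow_one]
      congr 1
      field_simp
    obtain ⟨-, k, hk⟩ := smul_dirVec_eq (mul_pos (by simpa using hl) hd) h1
    refine ⟨1 - 2 * k, ?_, ?_⟩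
    · push_cast at hk ⊢; linarith
    · rw [(show Odd (1 - 2 * k) from ⟨-k, by ring⟩).neg_one_zpow, abs_of_neg hl]; ring
  · have h1 : dirVec t = (l⁻¹ * d) • dirVec (act X t) := by
      rw [mul_smul, ← hX, smul_smul, inv_mul_cancel₀ hl.ne', one_smul]
    obtain ⟨-, k, hk⟩ := smul_dirVec_eq (mul_pos (inv_pos.mpr hl) hd) h1
    refine ⟨-(2 * k), ?_, ?_⟩
    · push_cast; linarith
    · rw [(show Even (-(2 * k)) from ⟨-k, by ring⟩).neg_one_zpow, abs_of_pos hl]; ring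

theorem act_pow_of_act_eq {X : PSLtilde} {t : ℝ} {m : ℤ} (h : act X t = t + m) (n : ℕ) :
    act (X ^ n) t = t + (n * m : ℤ) := by
  induction n with
  | zero => simp [act_one]
  | succ n ih =>
    rw [pow_succ, act_mul, h, act_add_int, ih]
    push_cast
    ring

theorem pow_mulVec_of_eigenvector {K : Type*} [Field K] {A : SpecialLinearGroup (Fin 2) K} {l : K}
    {v : Fin 2 → K} (h : (A : Matrix (Fin 2) (Fin 2) K) *ᵥ v = l • v) (n : ℕ) :
    ((A ^ n : SpecialLinearGroup (Fin 2) K) : Matrix (Fin 2) (Fin 2) K) *ᵥ v = l ^ n • v := by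
  induction n with
  | zero => simp
  | succ n ih =>
    rw [pow_succ, Matrix.SpecialLinearGroup.coe_mul, ← Matrix.mulVec_mulVec, h,
      Matrix.mulVec_smul, ih, smul_smul, pow_succ']

/-- An element of the universal cover with `X ^ n = sh(k)` has the trace of `sh(k / n)`. -/
theorem trace_of_pow_eq {X : PSLtilde} {n : ℕ} (hn : 0 < n) {k : ℤ} (h : X ^ n = shOne ^ k) :
    toSL X 0 0 + toSL X 1 1 = 2 * Real.cos (Real.pi * (k / n)) := by
  have hn' : (n : ℝ) ≠ 0 := by exact_mod_cast hn.ne'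
  set τ := toSL X 0 0 + toSL X 1 1 with hτ
  -- Elliptic elements are conjugate to rotations, whose powers are explicit. Otherwise there is a
  -- real eigenvector, and the power relation forces its eigenvalue to be `±1`.
  rcases lt_or_ge (τ ^ 2) 4 with h4 | h4
  · have hr : toSL X 1 0 ≠ 0 := by
      intro h0
      have := det_eq (toSL X)
      rw [h0] at this
      nlinarith [sq_nonneg (toSL X 0 0 - toSL X 1 1)]
    have hab : |τ / 2| < 1 := by
      rw [← sq_lt_one_iff_abs_lt_one]
      linarith [div_pow τ 2 2]
    rw [abs_lt] at hab
    have hcos : Real.cos (Real.arccos (τ / 2)) = τ / 2 := Real.cos_arccos hab.1.le hab.2.le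
    have hsin : 0 < Real.sin (Real.arccos (τ / 2)) := by
      rw [Real.sin_arccos]
      exact Real.sqrt_pos.mpr (by nlinarith)
    -- The trace gives `θ` only up to sign; the sign of the lower left entry decides.
    obtain ⟨θ, h1, h2⟩ : ∃ θ, τ = 2 * Real.cos θ ∧ 0 < toSL X 1 0 * Real.sin θ := by
      rcases lt_or_gt_of_ne hr with hr | hr
      · exact ⟨-Real.arccos (τ / 2), by rw [Real.cos_neg, hcos]; ring,
          by rw [Real.sin_neg]; nlinarith⟩
      · exact ⟨Real.arccos (τ / 2), by rw [hcos]; ring, mul_pos hr hsin⟩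
    have hθ : Real.pi * (θ / Real.pi) = θ := by field_simp
    obtain ⟨Y, j, hX⟩ := exists_eq_conj_sh (X := X) (s := θ / Real.pi) (by rw [hθ]; exact h1)
      (by rw [hθ]; exact h2)
    rw [hX, conj_sh_mul_pow] at h
    -- Integer translations are central, so the conjugating element drops out and the translation
    -- lengths can be compared.
    have h3 : sh (n * (θ / Real.pi)) = shOne ^ (k - 2 * j * n) := by
      have h4 : Y * sh (n * (θ / Real.pi)) * Y⁻¹ = shOne ^ (k - 2 * j * n) := by
        rw [zpow_sub, ← h, mul_inv_cancel_right]
      rw [mul_inv_eq_iff_eq_mul, (commute_shOne_zpow Y _).symm.eq] at h4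
      exact mul_left_cancel h4
    have h5 := congrArg (fun Z => act Z 0) h3
    simp only [act_sh, act_shOne_zpow, zero_add] at h5
    push_cast at h5
    have h6 : θ = Real.pi * (k / n) - j * (2 * Real.pi) := by
      field_simp at h5 ⊢
      linear_combination h5
    rw [h1, h6, Real.cos_sub_int_mul_two_pi]
  · set l := (τ + Real.sqrt (τ ^ 2 - 4)) / 2 with hl
    have hl2 : l ^ 2 - τ * l + 1 = 0 := by
      have := Real.sq_sqrt (show 0 ≤ τ ^ 2 - 4 by linarith)
      rw [hl]
      linear_combination this / 4
    obtain ⟨v, hv, hAv⟩ := exists_eigenvector hl2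
    obtain ⟨c, t, hc, rfl⟩ := exists_dirVec hv
    rw [Matrix.mulVec_smul, smul_comm] at hAv
    have hAt := smul_right_injective _ hc.ne' hAv
    obtain ⟨m, hm, hlm⟩ := act_of_eigenvector hAt
    have hk : k = n * m := by
      have := act_pow_of_act_eq hm n
      rw [h, act_shOne_zpow] at this
      exact_mod_cast add_left_cancel this
    have hln : l ^ n = (-1) ^ k := by
      have h1 := pow_mulVec_of_eigenvector hAt n
      rw [← map_pow, h, toSL_shOne_zpow, Matrix.smul_mulVec, Matrix.one_mulVec] at h1
      exact (smul_left_injective ℝ (dirVec_ne_zero t) h1).symm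
    have habs : |l| = 1 := by
      rw [← pow_eq_one_iff_of_nonneg (abs_nonneg l) hn.ne', ← abs_pow, hln, abs_zpow]
      simp
    rw [habs, mul_one] at hlm
    have hl1 : l ^ 2 = 1 := by rw [← sq_abs, habs, one_pow]
    have h7 : Real.pi * (k / n) = m * Real.pi := by
      rw [hk]; push_cast; field_simp
    rw [h7, Real.cos_int_mul_pi, ← hlm]
    clear_value l
    linear_combination (l - τ) * hl1 - l * hl2

/-! #### Triples of rotations -/

theorem act_strictMono (X : PSLtilde) : StrictMono (act X) := by
  rcases (act X).continuous.strictMono_of_inj (act X).injective with h | h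
  · exact h
  · have := h (lt_add_one (0 : ℝ))
    rw [act_add_one] at this
    linarith

/-- Elements of the universal cover preserve order and commute with integer translations, so
conjugation keeps a displacement strictly between consecutive integers. This bound later fixes the
integer ambiguity of lifts. -/
theorem act_conj_sh_mem (Y : PSLtilde) {s : ℝ} (h0 : -1 < s) (h1 : s < 0) (t : ℝ) :
    t - 1 < act (Y * sh s * Y⁻¹) t ∧ act (Y * sh s * Y⁻¹) t < t := by
  rw [act_mul, act_mul, act_sh]
  have ht := act_act_inv Y t
  constructor
  · have := act_strictMono Y (show act Y⁻¹ t + (-1 : ℤ) < act Y⁻¹ t + s by push_cast; linarith)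
    rw [act_add_int, ht] at this
    push_cast at this
    linarith
  · have := act_strictMono Y (show act Y⁻¹ t + s < act Y⁻¹ t by linarith)
    rwa [ht] at this

/-- With `D = diag(√d, 1/√d)`, the equation says that the rotation by `-π r₀` times the
`D`-conjugate of the rotation by `-π r₁` has trace `-2 cos(π r₂)`; the inequality fixes the sign of
its lower left entry. Dividing gives `d + 1/d = 2K`, where `K` is the hyperbolic cosine of the side
between the angles `π r₀` and `π r₁`, and `K > 1` amounts to `r₀ + r₁ + r₂ < 1`. -/
theorem exists_scale {r₀ r₁ r₂ : ℝ} (h₀ : 0 < r₀) (h₁ : 0 < r₁) (h₂ : 0 < r₂)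
    (hr : r₀ + r₁ + r₂ < 1) :
    ∃ d : ℝ, 0 < d ∧
      Real.sin (Real.pi * r₀) * Real.sin (Real.pi * r₁) * (d ^ 2 + 1) =
        2 * (Real.cos (Real.pi * r₀) * Real.cos (Real.pi * r₁) + Real.cos (Real.pi * r₂)) * d ∧
      0 < d * Real.sin (Real.pi * r₀) * Real.cos (Real.pi * r₁) +
        Real.cos (Real.pi * r₀) * Real.sin (Real.pi * r₁) := by
  have hpi := Real.pi_pos
  have hsin : ∀ {r : ℝ}, 0 < r → r < 1 → 0 < Real.sin (Real.pi * r) := fun h h' =>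
    Real.sin_pos_of_pos_of_lt_pi (by positivity) (by nlinarith)
  have s0 := hsin h₀ (by linarith)
  have s1 := hsin h₁ (by linarith)
  have s01 := hsin (add_pos h₀ h₁) (by linarith)
  have hcos : 0 < Real.cos (Real.pi * (r₀ + r₁)) + Real.cos (Real.pi * r₂) := by
    have : Real.cos (Real.pi - Real.pi * r₂) < Real.cos (Real.pi * (r₀ + r₁)) :=
      Real.cos_lt_cos_of_nonneg_of_le_pi (by positivity) (by nlinarith) (by nlinarith)
    rw [Real.cos_pi_sub] at this
    linarith
  rw [mul_add, Real.sin_add] at s01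
  rw [mul_add, Real.cos_add] at hcos
  have hc : 0 ≤ Real.cos (Real.pi * r₁) ∨ 0 ≤ Real.cos (Real.pi * r₀) := by
    rcases le_total r₁ (1 / 2) with h | h
    · exact Or.inl (Real.cos_nonneg_of_mem_Icc ⟨by nlinarith, by nlinarith⟩)
    · exact Or.inr (Real.cos_nonneg_of_mem_Icc ⟨by nlinarith, by nlinarith⟩)
  generalize Real.sin (Real.pi * r₀) = S₀ at *
  generalize Real.sin (Real.pi * r₁) = S₁ at *
  generalize Real.cos (Real.pi * r₀) = C₀ at *
  generalize Real.cos (Real.pi * r₁) = C₁ at *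
  generalize Real.cos (Real.pi * r₂) = C₂ at *
  set K := (C₀ * C₁ + C₂) / (S₀ * S₁) with hK
  have hK1 : 1 < K := by
    rw [hK, one_lt_div (mul_pos s0 s1)]
    linarith
  have hKm : S₀ * S₁ * K = C₀ * C₁ + C₂ := by rw [hK]; field_simp
  have hsq := Real.sq_sqrt (show 0 ≤ K ^ 2 - 1 by nlinarith)
  have hsq0 := Real.sqrt_nonneg (K ^ 2 - 1)
  set d := K + Real.sqrt (K ^ 2 - 1) with hd
  have hd1 : 1 < d := by linarith
  have hdq : d ^ 2 + 1 = 2 * K * d := by rw [hd]; linear_combination hsq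
  -- The two roots are reciprocal. The one that increases the term with nonnegative cosine keeps the
  -- expression at least a positive multiple of `sin(π(r₀ + r₁))`.
  rcases hc with hc | hc
  · refine ⟨d, by linarith, ?_, ?_⟩
    · rw [hdq]; linear_combination 2 * d * hKm
    · nlinarith [mul_nonneg (mul_nonneg s0.le hc) (sub_nonneg.mpr hd1.le)]
  · have hd0 : 0 < d := by linarith
    refine ⟨d⁻¹, inv_pos.mpr hd0, ?_, ?_⟩
    · field_simp
      linear_combination S₀ * S₁ * hdq + 2 * d * hKm
    · have h1 : 0 < S₀ * C₁ + d * (C₀ * S₁) := by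
        nlinarith [mul_nonneg (mul_nonneg hc s1.le) (sub_nonneg.mpr hd1.le)]
      have h2 : d⁻¹ * S₀ * C₁ + C₀ * S₁ = d⁻¹ * (S₀ * C₁ + d * (C₀ * S₁)) := by
        field_simp
      rw [h2]
      positivity

/-- For `r₀ + r₁ + r₂ < 1` there are conjugates of `sh(-r₀), sh(-r₁), sh(-r₂)` with product
`sh(-1)`: the rotations about the vertices of a hyperbolic triangle with angles `π rᵢ`. -/
theorem exists_triangle {r : Fin 3 → ℝ} (h : ∀ i, 0 < r i) (hr : r 0 + r 1 + r 2 < 1) :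
    ∃ Y : Fin 3 → PSLtilde, (Y 0 * sh (-r 0) * (Y 0)⁻¹) * (Y 1 * sh (-r 1) * (Y 1)⁻¹) *
      (Y 2 * sh (-r 2) * (Y 2)⁻¹) = shOne ^ (-1 : ℤ) := by
  obtain ⟨d, hd, hd1, hd2⟩ := exists_scale (h 0) (h 1) (h 2) hr
  set e := Real.sqrt d with he
  have he2 : e ^ 2 = d := Real.sq_sqrt hd.le
  have he0 : 0 < e := Real.sqrt_pos.mpr hd
  obtain ⟨D, hD, hD'⟩ : ∃ D, (toSL D : Matrix (Fin 2) (Fin 2) ℝ) = !![e, 0; 0, e⁻¹] ∧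
      (((toSL D)⁻¹ : SpecialLinearGroup (Fin 2) ℝ) : Matrix (Fin 2) (Fin 2) ℝ) =
        !![e⁻¹, 0; 0, e] := by
    obtain ⟨D, hD⟩ := toSL_surjective ⟨!![e, 0; 0, e⁻¹], by
      rw [Matrix.det_fin_two_of, mul_inv_cancel₀ he0.ne']; ring⟩
    have hD1 : (toSL D : Matrix (Fin 2) (Fin 2) ℝ) = !![e, 0; 0, e⁻¹] := congrArg Subtype.val hD
    refine ⟨D, hD1, ?_⟩
    rw [Matrix.SpecialLinearGroup.coe_inv, hD1, Matrix.adjugate_fin_two_of, neg_zero]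
  -- The third factor is forced to be `M⁻¹ sh(-1)`; its trace and lower left entry identify it as a
  -- conjugate of `sh(-r₂)`, up to an even translation.
  set M := sh (-r 0) * (D * sh (-r 1) * D⁻¹) with hM
  set X := M⁻¹ * shOne⁻¹ with hX
  have hXM : toSL X = -(toSL M)⁻¹ := by
    rw [hX, map_mul, map_inv, map_inv, toSL_shOne]; simp
  have eX00 : toSL X 0 0 = -toSL M 1 1 := by rw [hXM]; exact congrArg Neg.neg (inv_apply _).1
  have eX10 : toSL X 1 0 = toSL M 1 0 := by
    rw [hXM]; exact (congrArg Neg.neg (inv_apply _).2.1).trans (neg_neg _)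
  have eX11 : toSL X 1 1 = -toSL M 0 0 := by rw [hXM]; exact congrArg Neg.neg (inv_apply _).2.2
  have eM : (toSL M : Matrix (Fin 2) (Fin 2) ℝ) =
      rotMat (Real.pi * -r 0) * (!![e, 0; 0, e⁻¹] * rotMat (Real.pi * -r 1) *
        !![e⁻¹, 0; 0, e]) := by
    rw [hM, map_mul, map_mul, map_mul, map_inv, toSL_sh, toSL_sh, ← hD, ← hD',
      Matrix.SpecialLinearGroup.coe_mul, Matrix.SpecialLinearGroup.coe_mul,
      Matrix.SpecialLinearGroup.coe_mul]
  have e00 : toSL M 0 0 = Real.cos (Real.pi * r 0) * Real.cos (Real.pi * r 1) -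
      Real.sin (Real.pi * r 0) * Real.sin (Real.pi * r 1) / d := by
    rw [eM, ← he2]
    simp [rotMat]
    field_simp
    ring
  have e11 : toSL M 1 1 = Real.cos (Real.pi * r 0) * Real.cos (Real.pi * r 1) -
      Real.sin (Real.pi * r 0) * Real.sin (Real.pi * r 1) * d := by
    rw [eM, ← he2]
    simp [rotMat]
    field_simp
    ring
  have e10 : toSL M 1 0 = -(Real.sin (Real.pi * r 0) * Real.cos (Real.pi * r 1)) -
      Real.cos (Real.pi * r 0) * Real.sin (Real.pi * r 1) / d := by
    rw [eM, ← he2]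
    simp [rotMat]
    field_simp
    ring
  have hs2 : 0 < Real.sin (Real.pi * r 2) := 
    Real.sin_pos_of_pos_of_lt_pi (mul_pos Real.pi_pos (h 2))
      (by nlinarith [Real.pi_pos, h 0, h 1, h 2])
  obtain ⟨Y, j, hY⟩ := exists_eq_conj_sh (X := X) (s := -r 2) (by
      rw [eX00, eX11, e00, e11, mul_neg, Real.cos_neg]
      field_simp
      linear_combination hd1) (by
      rw [eX10, e10, mul_neg, Real.sin_neg]
      have : 0 < (d * Real.sin (Real.pi * r 0) * Real.cos (Real.pi * r 1) +
        Real.cos (Real.pi * r 0) * Real.sin (Real.pi * r 1)) / d * Real.sin (Real.pi * r 2) := by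
        positivity
      convert this using 1
      field_simp
      ring)
  have hlt : ∀ i, -1 < -r i ∧ -r i < 0 := fun i =>
    ⟨by fin_cases i <;> simp <;> linarith [h 0, h 1, h 2], by linarith [h i]⟩
  have hprod : M * X = shOne ^ (-1 : ℤ) := by
    rw [hX, mul_inv_cancel_left, zpow_neg_one]
  -- Follow the point 0: the three rotations move it by a total in `(-3, 0)`, and adding `2j` must
  -- give `-1`.
  have hj : j = 0 := by
    have h1 : act M (act X 0) = -1 := by
      rw [← act_mul, hprod, act_shOne_zpow]; simp
    have b2 := act_conj_sh_mem Y (hlt 2).1 (hlt 2).2 0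
    have eX : act X 0 = act (Y * sh (-r 2) * Y⁻¹) 0 + (2 * j : ℤ) := by
      rw [hY, (commute_shOne_zpow _ _).eq, act_mul, act_shOne_zpow]
    rw [eX] at h1
    set w := act (Y * sh (-r 2) * Y⁻¹) 0
    rw [hM, act_mul] at h1
    have b1 := act_conj_sh_mem D (hlt 1).1 (hlt 1).2 (w + (2 * j : ℤ))
    rw [act_sh] at h1
    push_cast at b1 h1
    have k1 : (j : ℝ) < 1 := by linarith [(hlt 0).1]
    have k2 : (-1 : ℝ) < j := by linarith [(hlt 0).2]
    have : j < 1 := by exact_mod_cast k1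
    have : -1 < j := by exact_mod_cast k2
    omega
  rw [hj, mul_zero, zpow_zero, mul_one] at hY
  refine ⟨![1, D, Y], ?_⟩
  simp only [Matrix.cons_val]
  rw [← hY, one_mul, inv_one, mul_one]
  exact hprod

end PSLtilde

/-! ### Extensions and lifts -/

/-- The homomorphism into the universal cover given by a pull-back extension. -/
def liftHom {a : Fin 3 → ℕ} {f : OrbifoldGroup a →* Matrix.ProjectiveSpecialLinearGroup (Fin 2) ℝ}
    {β : ℤ} {βs : Fin 3 → ℤ} (e : SeifertGroup a β βs ≃* pullback f) :
    SeifertGroup a β βs →* PSLtilde :=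
  (MonoidHom.snd _ _).comp ((pullback f).subtype.comp e.toMonoidHom)

theorem liftHom_h {a : Fin 3 → ℕ}
    {f : OrbifoldGroup a →* Matrix.ProjectiveSpecialLinearGroup (Fin 2) ℝ}
    {β : ℤ} {βs : Fin 3 → ℤ} {e : SeifertGroup a β βs ≃* pullback f}
    (he : IsExtensionEquiv f β βs e) : liftHom e (SeifertGroup.h a β βs) = PSLtilde.shOne :=
  congrArg Prod.snd he.2

theorem zpow_h_eq_one {a : Fin 3 → ℕ} {β : ℤ} {βs : Fin 3 → ℤ}
    {ψ : SeifertGroup a β βs →* PSLtilde} (hψ : ψ (SeifertGroup.h a β βs) = PSLtilde.shOne)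
    (k : ℤ) (hk : SeifertGroup.h a β βs ^ k = 1) : k = 0 := by
  have := congrArg ψ hk
  rw [map_zpow, hψ, map_one, ← zpow_zero PSLtilde.shOne] at this
  exact PSLtilde.shOne_zpow_injective this

/-- A homomorphism into the universal cover that sends `h` to `sh(1)` comes from a pull-back
extension. -/
theorem exists_isExtensionEquiv {a : Fin 3 → ℕ} {β : ℤ} {βs : Fin 3 → ℤ}
    (ψ : SeifertGroup a β βs →* PSLtilde) (hψ : ψ (SeifertGroup.h a β βs) = PSLtilde.shOne) :
    ∃ (f : OrbifoldGroup a →* Matrix.ProjectiveSpecialLinearGroup (Fin 2) ℝ)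
      (e : SeifertGroup a β βs ≃* pullback f), IsExtensionEquiv f β βs e := by
  have hh : PSLtilde.toPSL (ψ (SeifertGroup.h a β βs)) = 1 := by
    rw [hψ, PSLtilde.toPSL_shOne]
  let f : OrbifoldGroup a →* Matrix.ProjectiveSpecialLinearGroup (Fin 2) ℝ :=
    PresentedGroup.toGroup (f := fun i => PSLtilde.toPSL (ψ (SeifertGroup.x a β βs i))) (by
      intro r hr
      cases hr with
      | cone i =>
        simp only [map_pow, FreeGroup.lift_apply_of]
        rw [← map_pow, ← map_pow, SeifertGroup.x_pow, map_zpow, map_zpow, hh, one_zpow]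
      | prod =>
        simp only [map_mul, FreeGroup.lift_apply_of]
        rw [← map_mul, ← map_mul, ← map_mul, ← map_mul, SeifertGroup.x_mul_x_mul_x, map_zpow,
          map_zpow, hh, one_zpow])
  have hf : f.comp (toOrbifold a β βs) = PSLtilde.toPSL.comp ψ := by
    refine SeifertGroup.hom_ext (fun i => ?_) ?_
    · rw [MonoidHom.comp_apply, SeifertGroup.toOrbifold_x]
      exact PresentedGroup.toGroup.of _
    · rw [MonoidHom.comp_apply, SeifertGroup.toOrbifold_h, map_one, MonoidHom.comp_apply, hh]
  let E : SeifertGroup a β βs →* pullback f :=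
    ((toOrbifold a β βs).prod ψ).codRestrict (pullback f) (DFunLike.congr_fun hf)
  -- The five lemma by hand: both groups extend the orbifold group, and the kernels `⟨h⟩` and
  -- `⟨sh(1)⟩` correspond.
  have hE : Function.Bijective E := by
    constructor
    · rw [injective_iff_map_eq_one]
      intro g hg
      have h1 : toOrbifold a β βs g = 1 := congrArg (fun u : pullback f =>
        (u : OrbifoldGroup a × PSLtilde).1) hg
      have h2 : ψ g = 1 := congrArg (fun u : pullback f =>
        (u : OrbifoldGroup a × PSLtilde).2) hg
      obtain ⟨k, rfl⟩ := SeifertGroup.exists_zpow_of_toOrbifold_eq_one h1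
      rw [map_zpow, hψ, ← zpow_zero PSLtilde.shOne] at h2
      rw [PSLtilde.shOne_zpow_injective h2, zpow_zero]
    · rintro ⟨⟨γ, u⟩, hu⟩
      obtain ⟨g, rfl⟩ := SeifertGroup.toOrbifold_surjective (b := β) (bs := βs) γ
      have h1 : PSLtilde.toPSL u = PSLtilde.toPSL (ψ g) := by
        rw [← MonoidHom.comp_apply, ← hf]
        exact hu.symm
      obtain ⟨k, rfl⟩ := PSLtilde.eq_mul_shOne_zpow_of_toPSL_eq h1
      refine ⟨g * SeifertGroup.h a β βs ^ k, Subtype.ext (Prod.ext ?_ ?_)⟩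
      · change toOrbifold a β βs (g * SeifertGroup.h a β βs ^ k) = _
        rw [map_mul, map_zpow, SeifertGroup.toOrbifold_h, one_zpow, mul_one]
      · change ψ (g * SeifertGroup.h a β βs ^ k) = _
        rw [map_mul, map_zpow, hψ]
  exact ⟨f, MulEquiv.ofBijective E hE, fun g => rfl,
    Prod.ext SeifertGroup.toOrbifold_h hψ⟩

/-! ### Euler classes -/

/-- The numerator is additive and vanishes on the relators `aᵢxᵢ - x₀`. -/
theorem eulerNum_eq_of_eulerClass_eq {a : Fin 3 → ℕ} {β β' : ℤ} {βs βs' : Fin 3 → ℤ}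
    (h : eulerClass a β βs = eulerClass a β' βs') : eulerNum a β βs = eulerNum a β' βs' := by
  let N : ℤ × (Fin 3 → ℤ) →+ ℤ := AddMonoidHom.mk' (fun v => eulerNum a v.1 v.2) (by
    intro v w
    simp only [eulerNum, Prod.fst_add, Prod.snd_add, Pi.add_apply]
    ring)
  have hN : AddSubgroup.closure
      (Set.range fun i : Fin 3 => ((-1, Pi.single i (a i : ℤ)) : ℤ × (Fin 3 → ℤ))) ≤ N.ker := by
    rw [AddSubgroup.closure_le]
    rintro _ ⟨i, rfl⟩
    change eulerNum a (-1) (Pi.single i (a i : ℤ)) = 0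
    fin_cases i <;> simp [eulerNum] <;> ring
  have h1 : N (-(β, βs) + (β', βs')) = 0 := hN (QuotientAddGroup.eq.mp h)
  rw [map_add, map_neg] at h1
  change -eulerNum a β βs + eulerNum a β' βs' = 0 at h1
  linarith

/-- The Euler class determines the image of the fiber and the traces of the images of the
generators under an induced representation. -/
theorem character_of_isInduced {a : Fin 3 → ℕ} (ha : ∀ i, 0 < a i) {b : ℤ} {bs : Fin 3 → ℤ}
    (hb : eulerNum a b bs = 1) {β : ℤ} {βs : Fin 3 → ℤ}
    {ρ : SeifertGroup a b bs →* SpecialLinearGroup (Fin 2) ℝ}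
    (hρ : IsInduced (eulerClass a β βs) ρ) :
    ρ (SeifertGroup.h a b bs) = (-1) ^ eulerNum a β βs ∧
      ∀ i, ρ (SeifertGroup.x a b bs i) 0 0 + ρ (SeifertGroup.x a b bs i) 1 1 =
        2 * Real.cos (Real.pi * (eulerNum a β βs * bs i / a i)) := by
  obtain ⟨β', βs', f, e, p, heu, he, hp, rfl⟩ := hρ
  rw [eulerNum_eq_of_eulerClass_eq heu]
  obtain ⟨c, hc, hs⟩ := exists_twist ha hb β' βs'
  set n := eulerNum a β' βs'
  have hψ := liftHom_h he
  have hbase : ∀ g, baseRep e g = PSLtilde.toSL (liftHom e g) := fun g => rfl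
  -- The sign of `m` is lost in both character values, since `(-1)^m` and the cosine are even in
  -- `m`.
  obtain ⟨m, hm, hph⟩ : ∃ m : ℤ, (m = n ∨ m = -n) ∧
      p (SeifertGroup.h a b bs) = SeifertGroup.h a β' βs' ^ m := by
    rcases SeifertGroup.map_h_of_isUniversalAbelianCover hc hs hb (zpow_h_eq_one hψ) hp with h | h
    exacts [⟨n, Or.inl rfl, h⟩, ⟨-n, Or.inr rfl, h⟩]
  constructor
  · rw [MonoidHom.comp_apply, hbase, hph, map_zpow, map_zpow, hψ, PSLtilde.toSL_shOne]
    rcases hm with rfl | rfl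
    · rfl
    · rw [zpow_neg, ← inv_zpow, inv_neg, inv_one]
  · intro i
    have h1 : liftHom e (p (SeifertGroup.x a b bs i)) ^ a i =
        PSLtilde.shOne ^ (m * (-bs i)) := by
      rw [← map_pow, ← map_pow, SeifertGroup.x_pow, map_zpow, map_zpow, hph, map_zpow, hψ,
        zpow_mul]
    have h2 := PSLtilde.trace_of_pow_eq (ha i) h1
    rw [MonoidHom.comp_apply, hbase, h2]
    push_cast
    rcases hm with rfl | rfl
    · rw [← Real.cos_neg]
      congr 2
      ring
    · congr 2
      push_cast
      ring

/-- Every class in `E` induces a representation. -/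
theorem exists_isInduced {a : Fin 3 → ℕ} (ha : ∀ i, 0 < a i) {b : ℤ} {bs : Fin 3 → ℤ}
    (hb : eulerNum a b bs = 1) {βs : Fin 3 → ℤ} (hβ : ∀ i, 0 < βs i)
    (hsum : ∑ i, (βs i : ℚ) / (a i : ℚ) < 1) :
    ∃ ρ : SeifertGroup a b bs →* SpecialLinearGroup (Fin 2) ℝ,
      IsInduced (eulerClass a (-1) βs) ρ := by
  have ha' : ∀ i, (0 : ℝ) < a i := fun i => by exact_mod_cast ha i
  have hsum' : (βs 0 / a 0 + βs 1 / a 1 + βs 2 / a 2 : ℝ) < 1 := by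
    rw [Fin.sum_univ_three] at hsum
    exact_mod_cast hsum
  obtain ⟨Y, hY⟩ := PSLtilde.exists_triangle (r := fun i => (βs i : ℝ) / a i)
    (fun i => div_pos (by exact_mod_cast hβ i) (ha' i)) hsum'
  let ψ : SeifertGroup a (-1) βs →* PSLtilde :=
    SeifertGroup.lift (fun i => Y i * PSLtilde.sh (-(βs i / a i)) * (Y i)⁻¹) PSLtilde.shOne
      (fun i => (PSLtilde.commute_shOne _).symm)
      (fun i => by
        rw [conj_pow, PSLtilde.sh_pow]
        have : (a i : ℝ) * -(βs i / a i) = (-βs i : ℤ) := by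
          have := (ha' i).ne'
          push_cast
          field_simp
        rw [this, PSLtilde.sh_intCast, (PSLtilde.commute_shOne_zpow (Y i) _).eq,
          mul_inv_cancel_right, zpow_neg, inv_mul_cancel]) hY
  have hψ : ψ (SeifertGroup.h a (-1) βs) = PSLtilde.shOne := SeifertGroup.lift_h ..
  obtain ⟨f, e, he⟩ := exists_isExtensionEquiv ψ hψ
  obtain ⟨c, hc, hs⟩ := exists_twist ha hb (-1) βs
  -- The covering is injective only if its degree on the fiber is nonzero; here `n = a₀a₁a₂(∑ rᵢ -
  -- 1)`.
  have hn : eulerNum a (-1) βs ≠ 0 := by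
    intro h0
    have h0' : (eulerNum a (-1) βs : ℝ) = 0 := by exact_mod_cast h0
    have h1 : (eulerNum a (-1) βs : ℝ) =
        a 0 * a 1 * a 2 * (-1 + (βs 0 / a 0 + βs 1 / a 1 + βs 2 / a 2)) := by
      have := (ha' 0).ne'
      have := (ha' 1).ne'
      have := (ha' 2).ne'
      simp only [eulerNum]
      push_cast
      field_simp
      ring
    rw [h1] at h0'
    have h2 := mul_pos (mul_pos (ha' 0) (ha' 1)) (ha' 2)
    have := (mul_eq_zero.mp h0').resolve_left h2.ne'
    linarith
  exact ⟨_, -1, βs, f, e, SeifertGroup.cover hc hs, rfl, he,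
    SeifertGroup.isUniversalAbelianCover_cover hc hs hb hn (zpow_h_eq_one hψ), rfl⟩

/-! ### Irreducible representations of rank two -/

section Irreducible

variable {G : Type*} [Group G] {σ : G →* SpecialLinearGroup (Fin 2) ℂ}

theorem exists_eigenvector_of_not_isIrred (h : ¬ IsIrred σ) :
    ∃ v : Fin 2 → ℂ, v ≠ 0 ∧ ∀ g, ∃ l : ℂ, (σ g : Matrix (Fin 2) (Fin 2) ℂ) *ᵥ v = l • v := by
  unfold IsIrred at h
  push Not at h
  obtain ⟨W, hW, hbot, htop⟩ := h
  have h1 : Module.finrank ℂ W = 1 := by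
    have h2 := Submodule.finrank_lt htop
    rw [Module.finrank_fin_fun] at h2
    have h3 : Module.finrank ℂ W ≠ 0 := fun h => hbot (Submodule.finrank_eq_zero.mp h)
    omega
  obtain ⟨⟨v, hv⟩, hv0, hspan⟩ := finrank_eq_one_iff'.mp h1
  refine ⟨v, fun h => hv0 (Subtype.ext h), fun g => ?_⟩
  obtain ⟨l, hl⟩ := hspan ⟨_, hW g v hv⟩
  exact ⟨l, (congrArg Subtype.val hl).symm⟩

theorem IsIrred.eq_zero_of_eigenvector (h : IsIrred σ) {v : Fin 2 → ℂ}
    (hv : ∀ g, ∃ l : ℂ, (σ g : Matrix (Fin 2) (Fin 2) ℂ) *ᵥ v = l • v) : v = 0 := by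
  rcases h (Submodule.span ℂ {v}) (fun g w hw => by
    obtain ⟨c, rfl⟩ := Submodule.mem_span_singleton.mp hw
    obtain ⟨l, hl⟩ := hv g
    rw [Matrix.mulVec_smul, hl]
    exact Submodule.smul_mem _ _ (Submodule.smul_mem _ _ (Submodule.mem_span_singleton_self v)))
    with h | h
  · exact Submodule.span_singleton_eq_bot.mp h
  · by_contra hv0
    have h1 := finrank_span_singleton (K := ℂ) hv0
    rw [h, finrank_top, Module.finrank_fin_fun] at h1
    omega

/-- The elements that have `v` as an eigenvector. -/
def eigenSubgroup (σ : G →* SpecialLinearGroup (Fin 2) ℂ) (v : Fin 2 → ℂ) : Subgroup G where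
  carrier := {g | ∃ l : ℂ, (σ g : Matrix (Fin 2) (Fin 2) ℂ) *ᵥ v = l • v}
  one_mem' := ⟨1, by simp⟩
  mul_mem' := by
    rintro g g' ⟨l, hl⟩ ⟨l', hl'⟩
    refine ⟨l' * l, ?_⟩
    rw [map_mul, Matrix.SpecialLinearGroup.coe_mul, ← Matrix.mulVec_mulVec, hl',
      Matrix.mulVec_smul, hl, smul_smul]
  inv_mem' := by
    rintro g ⟨l, hl⟩
    have h1 : v = l • ((σ g⁻¹ : Matrix (Fin 2) (Fin 2) ℂ) *ᵥ v) := by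
      rw [← Matrix.mulVec_smul, ← hl, Matrix.mulVec_mulVec, ← Matrix.SpecialLinearGroup.coe_mul,
        ← map_mul, inv_mul_cancel]
      simp
    refine ⟨l⁻¹, ?_⟩
    by_cases h0 : l = 0
    · rw [h0, zero_smul] at h1
      rw [h1]
      simp
    · nth_rewrite 2 [h1]
      rw [smul_smul, inv_mul_cancel₀ h0, one_smul]

end Irreducible

/-! ### Conjugacy from traces -/

theorem trace_conj (P A : SpecialLinearGroup (Fin 2) ℂ) :
    trace ((P⁻¹ * A * P : SpecialLinearGroup (Fin 2) ℂ) : Matrix (Fin 2) (Fin 2) ℂ) =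
      trace (A : Matrix (Fin 2) (Fin 2) ℂ) := by
  rw [Matrix.SpecialLinearGroup.coe_mul, Matrix.trace_mul_comm, ← Matrix.SpecialLinearGroup.coe_mul,
    mul_inv_cancel_left]

/-- A pair of matrices without common eigenvector has a normal form with prescribed first
columns. -/
theorem exists_conj_columns {A B : SpecialLinearGroup (Fin 2) ℂ} {l : ℂ}
    (hl : l ^ 2 - trace (A : Matrix (Fin 2) (Fin 2) ℂ) * l + 1 = 0)
    (hAB : ∀ v : Fin 2 → ℂ, (∃ c : ℂ, (A : Matrix (Fin 2) (Fin 2) ℂ) *ᵥ v = c • v) →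
      (∃ c : ℂ, (B : Matrix (Fin 2) (Fin 2) ℂ) *ᵥ v = c • v) → v = 0) :
    ∃ P : SpecialLinearGroup (Fin 2) ℂ,
      (P⁻¹ * A * P) 0 0 = l ∧ (P⁻¹ * A * P) 1 0 = 0 ∧
      (P⁻¹ * B * P) 0 0 = 0 ∧ (P⁻¹ * B * P) 1 0 = 1 := by
  rw [Matrix.trace_fin_two] at hl
  obtain ⟨v, hv, hAv⟩ := PSLtilde.exists_eigenvector hl
  -- `δ = det(v, Bv)` is nonzero because `v` is not an eigenvector of `B`. After scaling by `κ` with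
  -- `κ²δ = 1`, the basis `(κv, κBv)` is the required `P`.
  set δ := v 0 * ((B : Matrix (Fin 2) (Fin 2) ℂ) *ᵥ v) 1 -
    v 1 * ((B : Matrix (Fin 2) (Fin 2) ℂ) *ᵥ v) 0 with hδ
  have hδ0 : δ ≠ 0 := by
    intro h0
    refine hv (hAB v ⟨l, hAv⟩ ?_)
    by_cases hv0 : v 0 = 0
    · have hv1 : v 1 ≠ 0 := fun h1 => hv (by ext i; fin_cases i <;> assumption)
      refine ⟨((B : Matrix (Fin 2) (Fin 2) ℂ) *ᵥ v) 1 / v 1, ?_⟩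
      rw [hδ, hv0, zero_mul, zero_sub, neg_eq_zero] at h0
      ext i
      fin_cases i
      · simpa [hv0, hv1] using h0
      · simp [hv1]
    · refine ⟨((B : Matrix (Fin 2) (Fin 2) ℂ) *ᵥ v) 0 / v 0, ?_⟩
      ext i
      fin_cases i
      · simp [hv0]
      · simp only [Fin.mk_one, Pi.smul_apply, smul_eq_mul]
        field_simp
        linear_combination h0 + hδ
  obtain ⟨κ, hκ⟩ := IsAlgClosed.exists_pow_nat_eq δ⁻¹ (n := 2) (by norm_num)
  have hA0 : A 0 0 * v 0 + A 0 1 * v 1 = l * v 0 := by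
    simpa [Matrix.mulVec, dotProduct] using congrFun hAv 0
  have hA1 : A 1 0 * v 0 + A 1 1 * v 1 = l * v 1 := by
    simpa [Matrix.mulVec, dotProduct] using congrFun hAv 1
  have hB : ∀ i, ((B : Matrix (Fin 2) (Fin 2) ℂ) *ᵥ v) i = B i 0 * v 0 + B i 1 * v 1 := fun i => by
    simp [Matrix.mulVec, dotProduct]
  rw [hB, hB] at hδ
  have hdet : κ ^ 2 * δ = 1 := by rw [hκ, inv_mul_cancel₀ hδ0]
  obtain ⟨P, hP⟩ : ∃ P : SpecialLinearGroup (Fin 2) ℂ, (P : Matrix (Fin 2) (Fin 2) ℂ) =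
      !![κ * v 0, κ * (B 0 0 * v 0 + B 0 1 * v 1);
        κ * v 1, κ * (B 1 0 * v 0 + B 1 1 * v 1)] := by
    refine ⟨⟨_, ?_⟩, rfl⟩
    rw [Matrix.det_fin_two_of]
    rw [hδ] at hdet
    linear_combination hdet
  rw [hδ] at hdet
  have hconj : ∀ C : SpecialLinearGroup (Fin 2) ℂ, ((P⁻¹ * C * P : SpecialLinearGroup (Fin 2) ℂ) :
      Matrix (Fin 2) (Fin 2) ℂ) = !![κ * (B 1 0 * v 0 + B 1 1 * v 1),
        -(κ * (B 0 0 * v 0 + B 0 1 * v 1)); -(κ * v 1), κ * v 0] * C *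
      !![κ * v 0, κ * (B 0 0 * v 0 + B 0 1 * v 1);
        κ * v 1, κ * (B 1 0 * v 0 + B 1 1 * v 1)] := by
    intro C
    rw [Matrix.SpecialLinearGroup.coe_mul, Matrix.SpecialLinearGroup.coe_mul,
      Matrix.SpecialLinearGroup.coe_inv, hP, Matrix.adjugate_fin_two_of]
  refine ⟨P, ?_, ?_, ?_, ?_⟩ <;> rw [hconj] <;>
    simp only [Matrix.mul_apply, Fin.sum_univ_two, Matrix.of_apply, Matrix.cons_val',
      Matrix.cons_val_zero, Matrix.cons_val_one, Matrix.cons_val_fin_one]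
  · linear_combination κ ^ 2 * (B 1 0 * v 0 + B 1 1 * v 1) * hA0 -
      κ ^ 2 * (B 0 0 * v 0 + B 0 1 * v 1) * hA1 + l * hdet
  · linear_combination -κ ^ 2 * v 1 * hA0 + κ ^ 2 * v 0 * hA1
  · ring
  · linear_combination hdet

/-- The determinants and the trace of `B` leave only the upper right entry of `A` open, and this
enters the trace of `AB` with coefficient 1. -/
theorem eq_of_columns {A B A' B' : SpecialLinearGroup (Fin 2) ℂ} {l : ℂ}
    (hA : A 0 0 = l ∧ A 1 0 = 0) (hB : B 0 0 = 0 ∧ B 1 0 = 1)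
    (hA' : A' 0 0 = l ∧ A' 1 0 = 0) (hB' : B' 0 0 = 0 ∧ B' 1 0 = 1)
    (htB : trace (B : Matrix (Fin 2) (Fin 2) ℂ) = trace (B' : Matrix (Fin 2) (Fin 2) ℂ))
    (htAB : trace ((A * B : SpecialLinearGroup (Fin 2) ℂ) : Matrix (Fin 2) (Fin 2) ℂ) =
      trace ((A' * B' : SpecialLinearGroup (Fin 2) ℂ) : Matrix (Fin 2) (Fin 2) ℂ)) :
    A = A' ∧ B = B' := by
  have dA := PSLtilde.det_eq A
  have dA' := PSLtilde.det_eq A'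
  have dB := PSLtilde.det_eq B
  have dB' := PSLtilde.det_eq B'
  rw [Matrix.trace_fin_two, Matrix.trace_fin_two] at htB
  rw [Matrix.trace_fin_two, Matrix.trace_fin_two] at htAB
  simp only [Matrix.SpecialLinearGroup.coe_mul, Matrix.mul_apply, Fin.sum_univ_two] at htAB
  rw [hA.1, hA.2] at dA htAB
  rw [hA'.1, hA'.2] at dA' htAB
  rw [hB.1, hB.2] at dB htAB
  rw [hB'.1, hB'.2] at dB' htAB
  rw [hB.1, hB'.1] at htB
  have hl : l ≠ 0 := by
    rintro rfl
    simp at dA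
  have eA : A 1 1 = A' 1 1 := mul_left_cancel₀ hl (by linear_combination dA - dA')
  have eB : B 1 1 = B' 1 1 := by linear_combination htB
  have eB0 : B 0 1 = B' 0 1 := by linear_combination dB' - dB
  have eA0 : A 0 1 = A' 0 1 := by
    rw [eA, eB] at htAB
    linear_combination htAB
  constructor
  · apply Subtype.ext
    ext i j
    fin_cases i <;> fin_cases j
    exacts [hA.1.trans hA'.1.symm, eA0, hA.2.trans hA'.2.symm, eA]
  · apply Subtype.ext
    ext i j
    fin_cases i <;> fin_cases j
    exacts [hB.1.trans hB'.1.symm, eB0, hB.2.trans hB'.2.symm, eB]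

/-- Two pairs of matrices without common eigenvectors are conjugate if their traces and the traces
of their products agree. -/
theorem exists_conj_of_trace_eq {A B A' B' : SpecialLinearGroup (Fin 2) ℂ}
    (hAB : ∀ v : Fin 2 → ℂ, (∃ c : ℂ, (A : Matrix (Fin 2) (Fin 2) ℂ) *ᵥ v = c • v) →
      (∃ c : ℂ, (B : Matrix (Fin 2) (Fin 2) ℂ) *ᵥ v = c • v) → v = 0)
    (hAB' : ∀ v : Fin 2 → ℂ, (∃ c : ℂ, (A' : Matrix (Fin 2) (Fin 2) ℂ) *ᵥ v = c • v) →
      (∃ c : ℂ, (B' : Matrix (Fin 2) (Fin 2) ℂ) *ᵥ v = c • v) → v = 0)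
    (htA : trace (A : Matrix (Fin 2) (Fin 2) ℂ) = trace (A' : Matrix (Fin 2) (Fin 2) ℂ))
    (htB : trace (B : Matrix (Fin 2) (Fin 2) ℂ) = trace (B' : Matrix (Fin 2) (Fin 2) ℂ))
    (htAB : trace ((A * B : SpecialLinearGroup (Fin 2) ℂ) : Matrix (Fin 2) (Fin 2) ℂ) =
      trace ((A' * B' : SpecialLinearGroup (Fin 2) ℂ) : Matrix (Fin 2) (Fin 2) ℂ)) :
    ∃ P : SpecialLinearGroup (Fin 2) ℂ, P * A * P⁻¹ = A' ∧ P * B * P⁻¹ = B' := by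
  obtain ⟨l, hl⟩ : ∃ l : ℂ, l ^ 2 - trace (A : Matrix (Fin 2) (Fin 2) ℂ) * l + 1 = 0 := by
    set τ := trace (A : Matrix (Fin 2) (Fin 2) ℂ)
    obtain ⟨s, hs⟩ := IsAlgClosed.exists_pow_nat_eq (τ ^ 2 - 4) (n := 2) (by norm_num)
    exact ⟨(τ + s) / 2, by linear_combination hs / 4⟩
  obtain ⟨P, p1, p2, p3, p4⟩ := exists_conj_columns hl hAB
  obtain ⟨Q, q1, q2, q3, q4⟩ := exists_conj_columns (htA ▸ hl) hAB'
  have hmul : ∀ R C D : SpecialLinearGroup (Fin 2) ℂ,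
      (R⁻¹ * C * R) * (R⁻¹ * D * R) = R⁻¹ * (C * D) * R := fun R C D => by group
  obtain ⟨h1, h2⟩ := eq_of_columns ⟨p1, p2⟩ ⟨p3, p4⟩ ⟨q1, q2⟩ ⟨q3, q4⟩
    (by rw [trace_conj, trace_conj, htB]) (by rw [hmul, hmul, trace_conj, trace_conj, htAB])
  have key : ∀ C D : SpecialLinearGroup (Fin 2) ℂ, P⁻¹ * C * P = Q⁻¹ * D * Q →
      (Q * P⁻¹) * C * (Q * P⁻¹)⁻¹ = D := fun C D h => by
    calc (Q * P⁻¹) * C * (Q * P⁻¹)⁻¹ = Q * (P⁻¹ * C * P) * Q⁻¹ := by group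
      _ = D := by rw [h]; group
  exact ⟨Q * P⁻¹, key _ _ h1, key _ _ h2⟩

theorem trace_inv (A : SpecialLinearGroup (Fin 2) ℂ) :
    trace ((A⁻¹ : SpecialLinearGroup (Fin 2) ℂ) : Matrix (Fin 2) (Fin 2) ℂ) =
      trace (A : Matrix (Fin 2) (Fin 2) ℂ) := by
  rw [Matrix.SpecialLinearGroup.coe_inv, Matrix.adjugate_fin_two, Matrix.trace_fin_two_of,
    Matrix.trace_fin_two, add_comm]

/-! ### Representations of Seifert groups determined by their characters -/

section Seifert

variable {a : Fin 3 → ℕ} {b : ℤ} {bs : Fin 3 → ℤ}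

theorem commute_neg_one_zpow {K : Type*} [Field K] (A : SpecialLinearGroup (Fin 2) K) (k : ℤ) :
    Commute A ((-1) ^ k) := by
  refine Commute.zpow_right ?_ k
  rw [Commute, SemiconjBy, mul_neg, neg_mul, mul_one, one_mul]

/-- Irreducible representations of a Seifert group that send `h` to the same power of `-1` and
have the same traces at the other generators are conjugate. -/
theorem exists_conj_of_character_eq {σ τ : SeifertGroup a b bs →* SpecialLinearGroup (Fin 2) ℂ}
    {n : ℤ} (hσ : IsIrred σ) (hτ : IsIrred τ) (hσh : σ (SeifertGroup.h a b bs) = (-1) ^ n)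
    (hτh : τ (SeifertGroup.h a b bs) = (-1) ^ n)
    (ht : ∀ i, trace (σ (SeifertGroup.x a b bs i) : Matrix (Fin 2) (Fin 2) ℂ) =
      trace (τ (SeifertGroup.x a b bs i) : Matrix (Fin 2) (Fin 2) ℂ)) :
    ∃ P : SpecialLinearGroup (Fin 2) ℂ, ∀ g, P * σ g * P⁻¹ = τ g := by
  have hx2 : SeifertGroup.x a b bs 2 =
      (SeifertGroup.x a b bs 0 * SeifertGroup.x a b bs 1)⁻¹ * SeifertGroup.h a b bs ^ b := by
    rw [← SeifertGroup.x_mul_x_mul_x, inv_mul_cancel_left]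
  have hx01 : SeifertGroup.x a b bs 0 * SeifertGroup.x a b bs 1 =
      SeifertGroup.h a b bs ^ b * (SeifertGroup.x a b bs 2)⁻¹ := by
    rw [← SeifertGroup.x_mul_x_mul_x, mul_inv_cancel_right]
  have common : ∀ χ : SeifertGroup a b bs →* SpecialLinearGroup (Fin 2) ℂ, IsIrred χ →
      χ (SeifertGroup.h a b bs) = (-1) ^ n → ∀ v : Fin 2 → ℂ,
      (∃ c : ℂ, (χ (SeifertGroup.x a b bs 0) : Matrix (Fin 2) (Fin 2) ℂ) *ᵥ v = c • v) →
      (∃ c : ℂ, (χ (SeifertGroup.x a b bs 1) : Matrix (Fin 2) (Fin 2) ℂ) *ᵥ v = c • v) →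
      v = 0 := by
    intro χ hχ hχh v h0 h1
    have hh : SeifertGroup.h a b bs ∈ eigenSubgroup χ v :=
      ⟨(-1) ^ n, by rw [hχh, coe_neg_one_zpow, Matrix.smul_mulVec, Matrix.one_mulVec]⟩
    refine hχ.eq_zero_of_eigenvector (SeifertGroup.mem_of_generators (eigenSubgroup χ v)
      (fun i => ?_) hh)
    fin_cases i
    · exact h0
    · exact h1
    · exact hx2 ▸ mul_mem (inv_mem (mul_mem (show _ ∈ eigenSubgroup χ v from h0)
        (show _ ∈ eigenSubgroup χ v from h1))) (zpow_mem hh b)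
  -- Since `x₀x₁ = h^b x₂⁻¹` and inversion preserves traces in `SL(2)`, the trace of the product is
  -- already determined by `x₂` and `h`.
  have htr : ∀ χ : SeifertGroup a b bs →* SpecialLinearGroup (Fin 2) ℂ,
      χ (SeifertGroup.h a b bs) = (-1) ^ n →
      trace ((χ (SeifertGroup.x a b bs 0) * χ (SeifertGroup.x a b bs 1) :
        SpecialLinearGroup (Fin 2) ℂ) : Matrix (Fin 2) (Fin 2) ℂ) =
      ((-1 : ℂ) ^ (n * b)) * trace (χ (SeifertGroup.x a b bs 2) : Matrix (Fin 2) (Fin 2) ℂ) := by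
    intro χ hχh
    rw [← map_mul, hx01, map_mul, map_zpow, hχh, ← zpow_mul, map_inv,
      Matrix.SpecialLinearGroup.coe_mul, coe_neg_one_zpow, Matrix.smul_mul, Matrix.one_mul,
      Matrix.trace_smul, trace_inv, smul_eq_mul]
  obtain ⟨P, h0, h1⟩ := exists_conj_of_trace_eq (common σ hσ hσh) (common τ hτ hτh) (ht 0) (ht 1)
    (by rw [htr σ hσh, htr τ hτh, ht 2])
  have hh : P * σ (SeifertGroup.h a b bs) * P⁻¹ = τ (SeifertGroup.h a b bs) := by
    rw [hσh, hτh, (commute_neg_one_zpow P n).eq, mul_inv_cancel_right]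
  have : (MulAut.conj P).toMonoidHom.comp σ = τ := by
    refine SeifertGroup.hom_ext (fun i => ?_) hh
    fin_cases i
    · exact h0
    · exact h1
    · change ((MulAut.conj P).toMonoidHom.comp σ) (SeifertGroup.x a b bs 2) =
        τ (SeifertGroup.x a b bs 2)
      simp only [hx2, map_mul, map_inv, map_zpow]
      rw [← h0, ← h1, ← hh]
      rfl
  exact ⟨P, fun g => DFunLike.congr_fun this g⟩

end Seifert

/-! ### Characters of the induced representations -/

theorem eigenvalue_root {A : SpecialLinearGroup (Fin 2) ℂ} {v : Fin 2 → ℂ} (hv : v ≠ 0) {l : ℂ}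
    (h : (A : Matrix (Fin 2) (Fin 2) ℂ) *ᵥ v = l • v) :
    l ^ 2 - trace (A : Matrix (Fin 2) (Fin 2) ℂ) * l + 1 = 0 := by
  have hdet : ((A : Matrix (Fin 2) (Fin 2) ℂ) - l • 1).det = 0 :=
    Matrix.exists_mulVec_eq_zero_iff.mp ⟨v, hv, by
      rw [Matrix.sub_mulVec, Matrix.smul_mulVec, Matrix.one_mulVec, h, sub_self]⟩
  rw [Matrix.det_fin_two] at hdet
  simp only [Matrix.sub_apply, Matrix.smul_apply, Matrix.one_apply_eq, smul_eq_mul, mul_one,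
    ne_eq, zero_ne_one, one_ne_zero, not_false_eq_true, Matrix.one_apply_ne, mul_zero,
    sub_zero] at hdet
  rw [Matrix.trace_fin_two]
  linear_combination hdet - PSLtilde.det_eq A

/-- The sign of the exponent is written `2u - 1` with `u ∈ {0, 1}`, which makes the later parity
count an identity between integers. -/
theorem exists_eq_exp_of_root {l : ℂ} {φ : ℝ} (h : l ^ 2 - (2 * Real.cos φ : ℝ) * l + 1 = 0) :
    ∃ u : ℤ, (u = 0 ∨ u = 1) ∧ l = Complex.exp (((2 * u - 1) * φ : ℝ) * Complex.I) := by
  have h1 : (l - Complex.exp (φ * Complex.I)) * (l - Complex.exp (-φ * Complex.I)) = 0 := by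
    have h2 : Complex.exp (φ * Complex.I) * Complex.exp (-φ * Complex.I) = 1 := by
      rw [← Complex.exp_add, neg_mul, add_neg_cancel, Complex.exp_zero]
    have h3 := Complex.two_cos (φ : ℂ)
    push_cast at h
    linear_combination h + h2 + l * h3
  rcases mul_eq_zero.mp h1 with h1 | h1
  · refine ⟨1, Or.inr rfl, ?_⟩
    rw [sub_eq_zero.mp h1]
    congr 1
    push_cast
    ring
  · refine ⟨0, Or.inl rfl, ?_⟩
    rw [sub_eq_zero.mp h1]
    congr 1
    push_cast
    ring

theorem neg_one_zpow_eq_exp (k : ℤ) :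
    (-1 : ℂ) ^ k = Complex.exp ((Real.pi * k : ℝ) * Complex.I) := by
  rw [← Complex.exp_pi_mul_I, ← Complex.exp_int_mul]
  congr 1
  push_cast
  ring

section Seifert

variable {a : Fin 3 → ℕ} {b : ℤ} {bs : Fin 3 → ℤ}

/-- On a common eigenvector the eigenvalues of the `xᵢ` are `exp(±iπ(rᵢ - cᵢ))` with product
`(-1)^(n b)`. As `∑ cᵢ = n b + 1`, a signed sum of the `rᵢ` is odd, although it lies strictly
between `-1` and `1`. -/
theorem isIrred_of_character (ha : ∀ i, 0 < a i) {βs c : Fin 3 → ℤ} {n : ℤ}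
    (hβ : ∀ i, 0 < βs i) (hsum : (∑ i, (βs i : ℚ) / (a i : ℚ)) < 1)
    (hc : ∀ i, a i * c i = βs i - n * bs i) (hs : -1 + c 0 + c 1 + c 2 = n * b)
    {σ : SeifertGroup a b bs →* SpecialLinearGroup (Fin 2) ℂ}
    (hσh : σ (SeifertGroup.h a b bs) = (-1) ^ n)
    (ht : ∀ i, trace (σ (SeifertGroup.x a b bs i) : Matrix (Fin 2) (Fin 2) ℂ) =
      (2 * Real.cos (Real.pi * (n * bs i / a i)) : ℝ)) : IsIrred σ := by
  by_contra hirr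
  obtain ⟨v, hv, hl⟩ := exists_eigenvector_of_not_isIrred hirr
  choose l hl using hl
  have hu : ∀ i, ∃ u : ℤ, (u = 0 ∨ u = 1) ∧ l (SeifertGroup.x a b bs i) =
      Complex.exp (((2 * u - 1) * (Real.pi * (n * bs i / a i)) : ℝ) * Complex.I) := fun i => by
    have := eigenvalue_root hv (hl (SeifertGroup.x a b bs i))
    rw [ht] at this
    exact exists_eq_exp_of_root this
  choose u hu01 hu using hu
  have hprod : l (SeifertGroup.x a b bs 0) * l (SeifertGroup.x a b bs 1) *
      l (SeifertGroup.x a b bs 2) = (-1) ^ (n * b) := by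
    have h1 : (σ (SeifertGroup.x a b bs 0 * SeifertGroup.x a b bs 1 * SeifertGroup.x a b bs 2) :
        Matrix (Fin 2) (Fin 2) ℂ) *ᵥ v = (-1 : ℂ) ^ (n * b) • v := by
      rw [SeifertGroup.x_mul_x_mul_x, map_zpow, hσh, ← zpow_mul, coe_neg_one_zpow,
        Matrix.smul_mulVec, Matrix.one_mulVec]
    rw [map_mul, map_mul, Matrix.SpecialLinearGroup.coe_mul, Matrix.SpecialLinearGroup.coe_mul,
      ← Matrix.mulVec_mulVec, ← Matrix.mulVec_mulVec, hl, Matrix.mulVec_smul, hl,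
      Matrix.mulVec_smul, Matrix.mulVec_smul, hl, smul_smul, smul_smul] at h1
    rw [← smul_left_injective ℂ hv h1]
    ring
  rw [hu, hu, hu, neg_one_zpow_eq_exp, ← Complex.exp_add, ← Complex.exp_add,
    Complex.exp_eq_exp_iff_exists_int] at hprod
  obtain ⟨k, hk⟩ := hprod
  set r : Fin 3 → ℝ := fun i => βs i / a i with hr
  have hφ : ∀ i, (n * bs i / a i : ℝ) = r i - c i := fun i => by
    have h1 : (a i : ℝ) ≠ 0 := by exact_mod_cast (ha i).ne'
    have h2 : (a i * c i : ℝ) = βs i - n * bs i := by exact_mod_cast hc i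
    simp only [hr]
    field_simp
    linear_combination h2
  have hk' : Real.pi * ((2 * u 0 - 1) * (r 0 - c 0) + (2 * u 1 - 1) * (r 1 - c 1) +
      (2 * u 2 - 1) * (r 2 - c 2)) = Real.pi * (n * b + 2 * k) := by
    have h1 : ((((2 * u 0 - 1) * (Real.pi * (r 0 - c 0)) + (2 * u 1 - 1) * (Real.pi * (r 1 - c 1)) +
        (2 * u 2 - 1) * (Real.pi * (r 2 - c 2)) : ℝ) : ℂ) * Complex.I) =
        ((Real.pi * (n * b + 2 * k) : ℝ) : ℂ) * Complex.I := by
      rw [hφ, hφ, hφ] at hk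
      push_cast at hk ⊢
      linear_combination hk
    have h2 := Complex.ofReal_injective (mul_right_cancel₀ Complex.I_ne_zero h1)
    linear_combination h2
  have hk2 := mul_left_cancel₀ Real.pi_ne_zero hk'
  have hsR : (-1 + c 0 + c 1 + c 2 : ℝ) = n * b := by exact_mod_cast hs
  set N := k + u 0 * c 0 + u 1 * c 1 + u 2 * c 2 with hN
  have hNR : (N : ℝ) = k + u 0 * c 0 + u 1 * c 1 + u 2 * c 2 := by rw [hN]; push_cast; ring
  have hr2 : (2 * u 0 - 1) * r 0 + (2 * u 1 - 1) * r 1 + (2 * u 2 - 1) * r 2 = 2 * N - 1 := by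
    linear_combination hk2 - hsR - 2 * hNR
  have hsum' : r 0 + r 1 + r 2 < 1 := by
    rw [Fin.sum_univ_three] at hsum
    have h : (βs 0 / a 0 + βs 1 / a 1 + βs 2 / a 2 : ℝ) < 1 := by exact_mod_cast hsum
    exact h
  have hpos : ∀ i, 0 < r i := fun i =>
    div_pos (by exact_mod_cast hβ i) (by exact_mod_cast ha i)
  have hub : ∀ i, -r i ≤ (2 * u i - 1) * r i ∧ (2 * u i - 1) * r i ≤ r i := fun i => by
    have := hpos i
    rcases hu01 i with h | h <;> rw [h] <;> constructor <;> push_cast <;> linarith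
  have k1 : (N : ℝ) < 1 := by linarith [(hub 0).2, (hub 1).2, (hub 2).2]
  have k2 : (0 : ℝ) < N := by linarith [(hub 0).1, (hub 1).1, (hub 2).1]
  have : N < 1 := by exact_mod_cast k1
  have : 0 < N := by exact_mod_cast k2
  omega

/-- The character values on `h` and on the generators determine the invariants of a class in `E`. -/
theorem ratio_eq_of_cos_eq {r r' : Fin 3 → ℝ} {c c' : Fin 3 → ℤ} (hr : ∀ i, 0 < r i)
    (hr' : ∀ i, 0 < r' i) (hs : r 0 + r 1 + r 2 < 1) (hs' : r' 0 + r' 1 + r' 2 < 1)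
    (hpar : Even (c 0 + c 1 + c 2 - (c' 0 + c' 1 + c' 2)))
    (hcos : ∀ i, Real.cos (Real.pi * (r i - c i)) = Real.cos (Real.pi * (r' i - c' i))) :
    r = r' := by
  have hlt : ∀ i, r i < 1 := fun i => by fin_cases i <;> simp <;> linarith [hr 0, hr 1, hr 2]
  have hlt' : ∀ i, r' i < 1 := fun i => by
    fin_cases i <;> simp <;> linarith [hr' 0, hr' 1, hr' 2]
  -- The integer shift contributes a sign to the cosine, which is injective on `[0, π]`; an odd
  -- difference of shifts replaces `rᵢ'` by `1 - rᵢ'`.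
  have key : ∀ i, (Even (c i - c' i) ∧ r i = r' i) ∨ (Odd (c i - c' i) ∧ r i = 1 - r' i) := by
    intro i
    have h1 : ∀ (s : ℝ) (k : ℤ), Real.cos (Real.pi * (s - k)) =
        (-1) ^ k * Real.cos (Real.pi * s) := fun s k => by
      rw [← Real.cos_sub_int_mul_pi]
      congr 1
      ring
    have hmem : ∀ s : ℝ, 0 < s → s < 1 → Real.pi * s ∈ Set.Icc 0 Real.pi := fun s h h' =>
      ⟨by positivity, by nlinarith [Real.pi_pos]⟩
    have h2 := hcos i
    rw [h1, h1] at h2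
    have h3 : Real.cos (Real.pi * r i) = (-1) ^ (c i - c' i) * Real.cos (Real.pi * r' i) := by
      have h4 : ((-1 : ℝ) ^ c i) * (-1) ^ c i = 1 := by
        rw [← mul_zpow]; simp
      rw [zpow_sub₀ (by norm_num), div_eq_mul_inv, ← inv_zpow, inv_neg, inv_one]
      linear_combination (-1 : ℝ) ^ c i * h2 - Real.cos (Real.pi * r i) * h4
    rcases Int.even_or_odd (c i - c' i) with hp | hp
    · left
      refine ⟨hp, ?_⟩
      rw [hp.neg_one_zpow, one_mul] at h3
      exact mul_left_cancel₀ Real.pi_ne_zero (Real.injOn_cos (hmem _ (hr i) (hlt i))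
        (hmem _ (hr' i) (hlt' i)) h3)
    · right
      refine ⟨hp, ?_⟩
      rw [hp.neg_one_zpow, neg_one_mul, ← Real.cos_pi_sub] at h3
      refine mul_left_cancel₀ Real.pi_ne_zero (Real.injOn_cos (hmem _ (hr i) (hlt i))
        (hmem _ (by linarith [hlt' i]) (by linarith [hr' i])) ?_)
      rw [h3]
      congr 1
      ring
  have p0 := hr 0
  have p1 := hr 1
  have p2 := hr 2
  have p0' := hr' 0
  have p1' := hr' 1
  have p2' := hr' 2
  rw [Int.even_iff] at hpar
  -- An odd number of exchanges contradicts `hpar`. Two exchanges give `rᵢ + rᵢ' + rⱼ + rⱼ' = 2`,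
  -- against both sums being less than 1.
  rcases key 0 with ⟨e0, q0⟩ | ⟨e0, q0⟩ <;> rcases key 1 with ⟨e1, q1⟩ | ⟨e1, q1⟩ <;>
    rcases key 2 with ⟨e2, q2⟩ | ⟨e2, q2⟩ <;>
    simp only [Int.even_iff, Int.odd_iff] at e0 e1 e2 <;>
    first
    | omega
    | (exfalso; linarith)
    | (ext i; fin_cases i <;> assumption)

theorem trace_complexify {G : Type*} [Group G] (ρ : G →* SpecialLinearGroup (Fin 2) ℝ) (g : G) :
    trace (complexify ρ g : Matrix (Fin 2) (Fin 2) ℂ) = ((ρ g 0 0 + ρ g 1 1 : ℝ) : ℂ) := by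
  rw [Matrix.trace_fin_two, Complex.ofReal_add]
  rfl

theorem complexify_neg_one_zpow {G : Type*} [Group G] {ρ : G →* SpecialLinearGroup (Fin 2) ℝ}
    {g : G} {n : ℤ} (h : ρ g = (-1) ^ n) : complexify ρ g = (-1) ^ n := by
  rw [complexify, MonoidHom.comp_apply, h, map_zpow]
  congr 1
  apply Subtype.ext
  ext i j
  fin_cases i <;> fin_cases j <;> simp

/-! ### Irreducibility, independence of choices and injectivity for classes in `E` -/

variable (ha : ∀ i, 0 < a i) (hb : eulerNum a b bs = 1)

include ha hb

theorem isIrred_of_isInduced {eu : EulerGroup a} (heu : eu ∈ eulerSet a)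
    {ρ : SeifertGroup a b bs →* SpecialLinearGroup (Fin 2) ℝ} (hρ : IsInduced eu ρ) :
    IsIrred (complexify ρ) := by
  obtain ⟨βs, hβ, hsum, rfl⟩ := heu
  obtain ⟨hh, ht⟩ := character_of_isInduced ha hb hρ
  obtain ⟨c, hc, hs⟩ := exists_twist ha hb (-1) βs
  exact isIrred_of_character ha (fun i => (hβ i).1) hsum hc hs (complexify_neg_one_zpow hh)
    (fun i => by rw [trace_complexify, ht])

theorem repClass_eq_of_isInduced {eu : EulerGroup a} (heu : eu ∈ eulerSet a)
    {ρ ρ' : SeifertGroup a b bs →* SpecialLinearGroup (Fin 2) ℝ} (hρ : IsInduced eu ρ)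
    (hρ' : IsInduced eu ρ') :
    repClass ρ (isIrred_of_isInduced ha hb heu hρ) =
      repClass ρ' (isIrred_of_isInduced ha hb heu hρ') := by
  have h := isIrred_of_isInduced ha hb heu hρ
  have h' := isIrred_of_isInduced ha hb heu hρ'
  obtain ⟨βs, hβ, hsum, rfl⟩ := heu
  obtain ⟨hh, ht⟩ := character_of_isInduced ha hb hρ
  obtain ⟨hh', ht'⟩ := character_of_isInduced ha hb hρ'
  exact Quotient.sound (exists_conj_of_character_eq h h' (complexify_neg_one_zpow hh)
    (complexify_neg_one_zpow hh') (fun i => by rw [trace_complexify, trace_complexify, ht, ht']))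

theorem eulerClass_eq_of_repClass_eq {eu eu' : EulerGroup a} (heu : eu ∈ eulerSet a)
    (heu' : eu' ∈ eulerSet a) {ρ ρ' : SeifertGroup a b bs →* SpecialLinearGroup (Fin 2) ℝ}
    (hρ : IsInduced eu ρ) (hρ' : IsInduced eu' ρ') (hi : IsIrred (complexify ρ))
    (hi' : IsIrred (complexify ρ')) (h : repClass ρ hi = repClass ρ' hi') : eu = eu' := by
  obtain ⟨P, hP⟩ := Quotient.exact h
  change ∀ g, P * complexify ρ g * P⁻¹ = complexify ρ' g at hP
  obtain ⟨βs, hβ, hsum, rfl⟩ := heu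
  obtain ⟨βs', hβ', hsum', rfl⟩ := heu'
  obtain ⟨hh, ht⟩ := character_of_isInduced ha hb hρ
  obtain ⟨hh', ht'⟩ := character_of_isInduced ha hb hρ'
  obtain ⟨c, hc, hs⟩ := exists_twist ha hb (-1) βs
  obtain ⟨c', hc', hs'⟩ := exists_twist ha hb (-1) βs'
  set n := eulerNum a (-1) βs
  set n' := eulerNum a (-1) βs'
  have ha' : ∀ i, (0 : ℝ) < a i := fun i => by exact_mod_cast ha i
  have hpar : Even (n - n') := by
    have h1 := hP (SeifertGroup.h a b bs)
    rw [complexify_neg_one_zpow hh, complexify_neg_one_zpow hh', (commute_neg_one_zpow P n).eq,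
      mul_inv_cancel_right] at h1
    have h2 : ((-1 : ℂ) ^ n) = (-1) ^ n' := by
      have h3 := congrArg (fun A : SpecialLinearGroup (Fin 2) ℂ =>
        (A : Matrix (Fin 2) (Fin 2) ℂ) 0 0) h1
      simpa [coe_neg_one_zpow] using h3
    rcases Int.even_or_odd n with hn | hn <;> rcases Int.even_or_odd n' with hn' | hn'
    · exact hn.sub hn'
    · rw [hn.neg_one_zpow, hn'.neg_one_zpow] at h2
      norm_num at h2
    · rw [hn.neg_one_zpow, hn'.neg_one_zpow] at h2
      norm_num at h2
    · exact hn.sub_odd hn'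
  have hφ : ∀ (βs c : Fin 3 → ℤ) (n : ℤ), (∀ i, a i * c i = βs i - n * bs i) → ∀ i,
      (n * bs i / a i : ℝ) = βs i / a i - c i := fun βs c n hc i => by
    have h1 := (ha' i).ne'
    have h2 : (a i * c i : ℝ) = βs i - n * bs i := by exact_mod_cast hc i
    field_simp
    linear_combination h2
  have hcos : ∀ i, Real.cos (Real.pi * (βs i / a i - c i)) =
      Real.cos (Real.pi * (βs' i / a i - c' i)) := fun i => by
    have h1 := congrArg (fun A : SpecialLinearGroup (Fin 2) ℂ =>
      trace (A : Matrix (Fin 2) (Fin 2) ℂ)) (hP (SeifertGroup.x a b bs i))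
    have h2 := trace_conj P⁻¹ (complexify ρ (SeifertGroup.x a b bs i))
    rw [inv_inv] at h2
    simp only [h2, trace_complexify, ht, ht', hφ βs c n hc, hφ βs' c' n' hc'] at h1
    have h3 := Complex.ofReal_injective h1
    linarith
  have hsum1 : ∀ βs : Fin 3 → ℤ, ∑ i, (βs i : ℚ) / (a i : ℚ) < 1 →
      (βs 0 / a 0 + βs 1 / a 1 + βs 2 / a 2 : ℝ) < 1 := fun βs hsum => by
    rw [Fin.sum_univ_three] at hsum
    exact_mod_cast hsum
  have hr := ratio_eq_of_cos_eq (r := fun i => (βs i / a i : ℝ)) (r' := fun i => (βs' i / a i : ℝ))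
    (c := c) (c' := c') (fun i => div_pos (by exact_mod_cast (hβ i).1) (ha' i))
    (fun i => div_pos (by exact_mod_cast (hβ' i).1) (ha' i)) (hsum1 βs hsum) (hsum1 βs' hsum')
    (by
      -- The fiber only detects `n` modulo 2, but `∑ cᵢ = n b + 1` makes this the parity that is
      -- needed.
      have : c 0 + c 1 + c 2 - (c' 0 + c' 1 + c' 2) = (n - n') * b := by
        linear_combination hs - hs'
      rw [this]
      exact hpar.mul_right b) hcos
  have : βs = βs' := by
    ext i
    have h1 : (βs i / a i : ℝ) = βs' i / a i := congrFun hr i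
    rw [div_left_inj' (ha' i).ne'] at h1
    exact_mod_cast h1
  rw [this]

end Seifert

end Brieskorn

end

theorem mainTheorem4 (a : Fin 3 → ℕ) (ha : ∀ i, 0 < a i)
    (hcop : ∀ i j, i ≠ j → Nat.Coprime (a i) (a j)) (b : ℤ) (bs : Fin 3 → ℤ)
    (hb : (∏ i, (a i : ℚ)) * ((b : ℚ) + ∑ i, (bs i : ℚ) / (a i : ℚ)) = 1) :
    (∀ eu ∈ Brieskorn.eulerSet a,
      ∃ ρ : Brieskorn.SeifertGroup a b bs →* Matrix.SpecialLinearGroup (Fin 2) ℝ,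
        Brieskorn.IsInduced eu ρ) ∧
    ∃ Φ : Brieskorn.eulerSet a → Brieskorn.RepClasses (Brieskorn.SeifertGroup a b bs),
      (∀ (eu : Brieskorn.eulerSet a)
        (ρ : Brieskorn.SeifertGroup a b bs →* Matrix.SpecialLinearGroup (Fin 2) ℝ),
        Brieskorn.IsInduced (eu : Brieskorn.EulerGroup a) ρ →
          ∃ hρ : Brieskorn.IsIrred (Brieskorn.complexify ρ), Φ eu = Brieskorn.repClass ρ hρ) ∧
      Function.Injective Φ := by
  have hb' : Brieskorn.eulerNum a b bs = 1 := Brieskorn.SeifertGroup.cleared_of_euler ha hb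
  have hex : ∀ eu ∈ Brieskorn.eulerSet a,
      ∃ ρ : Brieskorn.SeifertGroup a b bs →* Matrix.SpecialLinearGroup (Fin 2) ℝ,
        Brieskorn.IsInduced eu ρ := by
    rintro _ ⟨βs, hβ, hsum, rfl⟩
    exact Brieskorn.exists_isInduced ha hb' (fun i => (hβ i).1) hsum
  refine ⟨hex, ?_⟩
  -- Any choice of induced representations defines `Φ`, since the class does not depend on it.
  choose R hR using hex
  refine ⟨fun eu => Brieskorn.repClass (R eu eu.2)
    (Brieskorn.isIrred_of_isInduced ha hb' eu.2 (hR eu eu.2)), fun eu ρ hρ =>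
    ⟨Brieskorn.isIrred_of_isInduced ha hb' eu.2 hρ,
      Brieskorn.repClass_eq_of_isInduced ha hb' eu.2 (hR eu eu.2) hρ⟩, fun eu eu' h => ?_⟩
  exact Subtype.ext (Brieskorn.eulerClass_eq_of_repClass_eq ha hb' eu.2 eu'.2 (hR eu eu.2)
    (hR eu' eu'.2) _ _ h)
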